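/- For $n\ge 0$ and permutations $\pi,\sigma$ of $[n]=\{1,\dots,n\}$ let $d_\alpha(\pi,\sigma)=\sum_{i=1}^n|\pi(i)-\sigma(i)|^\alpha$. The $L_\alpha$-Mallows distribution with central ranking $\sigma$ and dispersion $\beta$ is the probability distribution $\mathbb P_{\alpha,\beta,\sigma}(\pi)=e^{-\beta d_\alpha(\pi,\sigma)}/Z_n(\beta,\alpha)$ on $S_n$, where $Z_n(\beta,\alpha)=\sum_{\pi\in S_n}e^{-\beta d_\alpha(\pi,\sigma)}$ (which does not depend on $\sigma$). For $k\in\mathbb N$ let $A_n^{(k)}$ be the $n\times n$ matrix with entries $e^{-\beta|i-j|^\alpha}\mathbf 1_{\{|i-j|\le k\}}$, and let $\mathbb P^{(k)}_{\alpha,\beta,\sigma}$ be the distribution on $S_n$ with $\mathbb P^{(k)}_{\alpha,\beta,\sigma}(\pi)$ proportional to $\prod_{i=1}^n A_n^{(k)}[\sigma(i),\pi(i)]$. Algorithms are programs of a random access machine with a memory for integers and one for real numbers, whose program text is finite and contains no constants other than natural numbers. At unit cost it performs exact real arithmetic ($+,-,\times,/,\exp,\log$) and comparisons, integer addition, subtraction,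 division with remainder and comparisons, conversion of integers to reals, indirect addressing, and (if randomized) the toss of a coin whose bias is a computed real number. Theorem. For every $\alpha\ge 1$ and $\beta>0$ there is a fully polynomial-time approximation scheme for the $L_\alpha$-Mallows distribution. That is, there are a deterministic program (the estimator), a randomized program (the sampler), constants $C,D,K$ and band half-widths $k=k(n,\epsilon)\in\mathbb N$ with $k\le K\,(1+\log(1+n/\epsilon))$, all depending only on $\alpha$ and $\beta$, such that for every $n\ge 0$ and every $\epsilon>0$: (i) on input $(n,\alpha,\beta,\epsilon)$ the estimator halts within $C\,(n+1/\epsilon+1)^D$ steps and returns $\hat Z=\operatorname{per}(A_n^{(k)})$, and $(1-\epsilon)\,Z_n(\beta,\alpha)\le \hat Z\le Z_n(\beta,\alpha)$; (ii) for every $\sigma\in S_n$, on input $(n,\alpha,\beta,\epsilon,\sigma)$ the sampler halts, for every outcome of its coins, within $C\,(n+1/\epsilon+1)^D$ steps and returns a random permutation with distribution exactly $\mathbb P^{(k)}_{\alpha,\beta,\sigma}$, and the total variation distance between $\mathbb P^{(k)}_{\alpha,\beta,\sigma}$ and $\mathbb P_{\alpha,\beta,\sigma}$ is at most $\epsilon$.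 -/

import Mathlib

noncomputable section

/-! ### The `L_α`-Mallows model -/

namespace Mallows

open Equiv

variable {n : ℕ}

/-- The distance `d_α(π, σ) = ∑ i, |π(i) - σ(i)| ^ α` between two rankings. -/
def dist (α : ℝ) (π σ : Perm (Fin n)) : ℝ :=
  ∑ i, |((π i : ℕ) : ℝ) - ((σ i : ℕ) : ℝ)| ^ α

/-- The partition function `∑ π, exp (-β d_α(π, σ))`. -/
def partitionFunction (α β : ℝ) (σ : Perm (Fin n)) : ℝ :=
  ∑ π : Perm (Fin n), Real.exp (-β * dist α π σ)

/-- The probability distribution on a finite type proportional to a nonnegative weight `w` that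
is positive somewhere. -/
def proportionalTo {Ω : Type*} [Fintype Ω] (w : Ω → ℝ) (h : ∃ a, 0 < w a) : PMF Ω :=
  PMF.normalize (fun a => ENNReal.ofReal (w a))
    (by
      obtain ⟨a, ha⟩ := h
      intro h0
      have := ENNReal.tsum_eq_zero.1 h0 a
      exact absurd (ENNReal.ofReal_eq_zero.1 this) (not_le.2 ha))
    (by
      rw [tsum_fintype]
      exact ENNReal.sum_ne_top.2 (fun a _ => ENNReal.ofReal_ne_top))

/-- The `L_α`-Mallows distribution with central ranking `σ` and dispersion `β`: the probability
of `π` is `exp (-β d_α(π, σ))` divided by the partition function. -/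
def mallows (α β : ℝ) (σ : Perm (Fin n)) : PMF (Perm (Fin n)) :=
  proportionalTo (fun π => Real.exp (-β * dist α π σ)) ⟨1, Real.exp_pos _⟩

/-- The weight matrix `exp (-β |i - j| ^ α)`, with the entries with `|i - j| > k` set to zero. -/
def bandMatrix (n : ℕ) (α β : ℝ) (k : ℕ) : Matrix (Fin n) (Fin n) ℝ :=
  fun i j =>
    if |((i : ℕ) : ℝ) - ((j : ℕ) : ℝ)| ≤ (k : ℝ) then
      Real.exp (-β * |((i : ℕ) : ℝ) - ((j : ℕ) : ℝ)| ^ α)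
    else 0

/-- The Mallows distribution truncated to the band of half-width `k`: the probability of `π` is
proportional to `∏ i, A (σ i) (π i)`, where `A` is the band matrix. -/
def truncatedMallows (α β : ℝ) (k : ℕ) (σ : Perm (Fin n)) : PMF (Perm (Fin n)) :=
  proportionalTo (fun π => ∏ i, bandMatrix n α β k (σ i) (π i))
    ⟨σ, Finset.prod_pos (fun i _ => by simp [bandMatrix, Real.exp_pos])⟩

/-- Total variation distance of two distributions on a finite type. -/
def tvDist {Ω : Type*} [Fintype Ω] (p q : PMF Ω) : ℝ :=
  (1 / 2) * ∑ a, |(p a).toReal - (q a).toReal|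

/-- A ranking as the list of its values, counted from `0`. -/
def values (π : Perm (Fin n)) : Fin n → ℕ := fun i => (π i : ℕ)

end Mallows

/-! ### Randomized real random access machines

A program is a fixed finite text over two memories, one for natural numbers and one for real
numbers; each consists of arrays with a fixed name and a computed index.
The only constants in a program are natural numbers.
Exact real arithmetic (with `exp` and `log`) and the comparison of reals have unit cost. There is
no rounding from reals to integers, and integers cannot be multiplied in unit time, so their length
grows by a bounded number of bits in each step. -/

namespace RealRAM

structure State where
  /-- `nat a i` is the cell with index `i` of the integer array with name `a`. -/
  nat : ℕ → ℕ → ℕ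
  /-- `real a i` is the cell with index `i` of the real array with name `a`. -/
  real : ℕ → ℕ → ℝ

/-- Integer expressions. -/
inductive NExpr where
  | const (c : ℕ)
  | load (a : ℕ) (idx : NExpr)
  | add (x y : NExpr)
  | sub (x y : NExpr)
  | div (x y : NExpr)
  | mod (x y : NExpr)

/-- Real expressions. -/
inductive RExpr where
  | ofNat (x : NExpr)
  | load (a : ℕ) (idx : NExpr)
  | add (x y : RExpr)
  | sub (x y : RExpr)
  | mul (x y : RExpr)
  | div (x y : RExpr)
  | exp (x : RExpr)
  | log (x : RExpr)

/-- Tests. -/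
inductive Test where
  | natLe (x y : NExpr)
  | realLe (x y : RExpr)
  | not (t : Test)
  | and (t u : Test)

/-- Programs. -/
inductive Prog where
  | skip
  | setNat (a : ℕ) (idx : NExpr) (x : NExpr)
  | setReal (a : ℕ) (idx : NExpr) (x : RExpr)
  | seq (p q : Prog)
  | ite (t : Test) (p q : Prog)
  | while (t : Test) (p : Prog)
  /-- Continue with `p` with probability `x` (clipped to `[0, 1]`), and with `q` otherwise, by
  a fresh independent coin. -/
  | flip (x : RExpr) (p q : Prog)

/-- Value of an integer expression: subtraction is truncated at `0`, `div` and `mod` are quotient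
and remainder. -/
def NExpr.eval (s : State) : NExpr → ℕ
  | .const c => c
  | .load a i => s.nat a (i.eval s)
  | .add x y => x.eval s + y.eval s
  | .sub x y => x.eval s - y.eval s
  | .div x y => x.eval s / y.eval s
  | .mod x y => x.eval s % y.eval s

def RExpr.eval (s : State) : RExpr → ℝ
  | .ofNat x => (x.eval s : ℝ)
  | .load a i => s.real a (i.eval s)
  | .add x y => x.eval s + y.eval s
  | .sub x y => x.eval s - y.eval s
  | .mul x y => x.eval s * y.eval s
  | .div x y => x.eval s / y.eval s
  | .exp x => Real.exp (x.eval s)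
  | .log x => Real.log (x.eval s)

def Test.holds (s : State) : Test → Prop
  | .natLe x y => x.eval s ≤ y.eval s
  | .realLe x y => x.eval s ≤ y.eval s
  | .not t => ¬ t.holds s
  | .and t u => t.holds s ∧ u.holds s

def State.setNat (s : State) (a i v : ℕ) : State :=
  { s with nat := Function.update s.nat a (Function.update (s.nat a) i v) }

def State.setReal (s : State) (a i : ℕ) (v : ℝ) : State :=
  { s with real := Function.update s.real a (Function.update (s.real a) i v) }

/-- A coin that shows `true` with probability `x`, clipped to `[0, 1]`. -/
def coin (x : ℝ) : PMF Bool :=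
  PMF.ofFintype
    (fun b => if b then ENNReal.ofReal (max 0 (min x 1)) else
      ENNReal.ofReal (1 - max 0 (min x 1)))
    (by
      have h0 : 0 ≤ max 0 (min x 1) := le_max_left _ _
      have h1 : max 0 (min x 1) ≤ 1 := max_le zero_le_one (min_le_right _ _)
      simp only [Fintype.sum_bool, if_true, Bool.false_eq_true, if_false]
      rw [← ENNReal.ofReal_add h0 (sub_nonneg.2 h1)]
      simp)

/-- The stack of programs still to be executed, and the memory. -/
abbrev Config := List Prog × State

open Classical in
/-- One step of the machine. The expressions in a program are fixed and finite, so that a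
step performs a number of elementary operations bounded by a constant of the program. -/
def step : Config → PMF Config
  | ([], s) => PMF.pure ([], s)
  | (.skip :: r, s) => PMF.pure (r, s)
  | (.setNat a i x :: r, s) => PMF.pure (r, s.setNat a (i.eval s) (x.eval s))
  | (.setReal a i x :: r, s) => PMF.pure (r, s.setReal a (i.eval s) (x.eval s))
  | (.seq p q :: r, s) => PMF.pure (p :: q :: r, s)
  | (.ite t p q :: r, s) => PMF.pure ((if t.holds s then p else q) :: r, s)
  | (.while t p :: r, s) => PMF.pure (if t.holds s then p :: .while t p :: r else r, s)
  | (.flip x p q :: r, s) =>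
      (coin (x.eval s)).bind fun b => PMF.pure ((if b then p else q) :: r, s)

/-- Distribution of the configuration after `T` steps. -/
def run : ℕ → Config → PMF Config
  | 0, c => PMF.pure c
  | T + 1, c => (step c).bind (run T)

/-- Started on `s`, the program halts within `T` steps, whatever the coins show. -/
def Prog.HaltsWithin (p : Prog) (s : State) (T : ℕ) : Prop :=
  ∀ c ∈ (run T ([p], s)).support, c.1 = []

/-- Distribution of the memory after `T` steps. -/
def Prog.memoryAfter (p : Prog) (s : State) (T : ℕ) : PMF State :=
  (run T ([p], s)).map Prod.snd

/-- The program tosses no coins. -/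
def Prog.Deterministic : Prog → Prop
  | .skip => True
  | .setNat _ _ _ => True
  | .setReal _ _ _ => True
  | .seq p q => p.Deterministic ∧ q.Deterministic
  | .ite _ p q => p.Deterministic ∧ q.Deterministic
  | .while _ p => p.Deterministic
  | .flip _ _ _ => False

/-- Input of the estimator: `n` in cell `0` of integer array `0`, and `α, β, ε` in cells
`0, 1, 2` of real array `0`; all other cells are `0`. -/
def input (n : ℕ) (α β ε : ℝ) : State where
  nat a i := if a = 0 ∧ i = 0 then n else 0
  real a i := if a = 0 then (if i = 0 then α else if i = 1 then β else if i = 2 then ε else 0)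
    else 0

/-- Input of the sampler: the same, with the central ranking in integer array `1`. -/
def inputWithCenter {n : ℕ} (α β ε : ℝ) (σ : Equiv.Perm (Fin n)) : State :=
  { input n α β ε with
    nat := fun a i =>
      if a = 1 then (if h : i < n then (σ ⟨i, h⟩ : ℕ) else 0) else (input n α β ε).nat a i }

/-- The real number that a program returns: cell `0` of real array `1`. -/
def State.realOutput (s : State) : ℝ := s.real 1 0

/-- The list of `n` integers that a program returns: cells `0, …, n - 1` of integer array `2`. -/
def State.listOutput (n : ℕ) (s : State) : Fin n → ℕ := fun i => s.nat 2 i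

end RealRAM

end

/-!
For `α ≥ 1` the cost `|i - j| ^ α` remains Monge after subtraction of `|i - j|`, so exchanging the
values of two positions whose arcs `i → π i` cross a cut in opposite directions gains a factor
exponential in the distance of these arcs from the cut. Charging each permutation to the result of
such an exchange shows that many arcs over a cut are unlikely; and if few arcs cross the cuts at `i`
and at `j`, an arc from `i` to beyond `j` can be exchanged for one that ends shortly before `j`, in
boundedly many ways. Hence the weight of `j < π i` contracts by a constant factor whenever `j` grows
by a constant, and a band of half-width `O(log (1 + n / ε))` carries all but a fraction `ε` of the
partition function.

The permanent of a band matrix is expanded row by row. The state is the row together with the set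
of the occupied columns of the window around the diagonal, a mask of `2 * k + 1` bits, so a table of
polynomial size holds all partial permanents. Reading the table backwards gives the conditional
distribution of the next value of a permutation, which reservoir sampling realizes with one coin
toss per column of the window.
-/

namespace Mallows

open Equiv Finset

section Monge

/-- The Monge inequality for the cost `c a b` of matching a position `a` with a value `b`: crossing
pairs are at least as expensive as the uncrossed ones. -/
def IsMonge (c : ℕ → ℕ → ℝ) : Prop :=
  ∀ ⦃a a' b b' : ℕ⦄, a ≤ a' → b ≤ b' → c a b + c a' b' ≤ c a b' + c a' b

/-- The costs that remain Monge after subtraction of `|a - b|`: uncrossing a pair saves at least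
what it saves in total displacement. -/
def IsStronglyMonge (c : ℕ → ℕ → ℝ) : Prop :=
  IsMonge fun a b => c a b - |(a : ℝ) - b|

/-- The cost of the `L_α` distance. -/
noncomputable def powerCost (α : ℝ) (a b : ℕ) : ℝ := |(a : ℝ) - b| ^ α

variable {c : ℕ → ℕ → ℝ}

theorem isMonge_abs_sub : IsMonge fun a b => |(a : ℝ) - b| := by
  intro a a' b b' ha hb
  have ha' : (a : ℝ) ≤ a' := Nat.cast_le.2 ha
  have hb' : (b : ℝ) ≤ b' := Nat.cast_le.2 hb
  grind

theorem isMonge_comp_sub {f : ℤ → ℝ} (hf : Monotone fun t => f (t + 1) - f t) :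
    IsMonge fun a b => f (a - b) := by
  have increments_le {x y : ℤ} (hxy : x ≤ y) (s : ℕ) : f (x + s) - f x ≤ f (y + s) - f y := by
    induction s with
    | zero => simp
    | succ s ih =>
      have h : f (x + s + 1) - f (x + s) ≤ f (y + s + 1) - f (y + s) :=
        hf (add_le_add_left hxy s)
      push_cast
      rw [← add_assoc, ← add_assoc]
      linarith
  intro a a' b b' ha hb
  have h := increments_le (show (a : ℤ) - b' ≤ a' - b' by lia) (b' - b)
  rw [Nat.cast_sub hb, sub_add_sub_cancel, sub_add_sub_cancel] at h
  linarith

namespace IsStronglyMonge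

protected theorem isMonge (hc : IsStronglyMonge c) : IsMonge c := fun a a' b b' ha hb => by
  have h₁ := hc ha hb
  have h₂ := isMonge_abs_sub ha hb
  simp only at h₁ h₂
  linarith

protected theorem swap (hc : IsStronglyMonge c) : IsStronglyMonge (Function.swap c) :=
  fun a a' b b' ha hb => by
    have h := hc hb ha
    simp only [Function.swap, abs_sub_comm] at h ⊢
    linarith

theorem uncross (hc : IsStronglyMonge c) {a b d e m : ℕ} (ha : a ≤ m) (he : e ≤ m) (hb : m < b)
    (hd : m < d) :
    c a e + c d b + (2 * (min (m - a) (m - e) + min (d - m) (b - m)) : ℕ) ≤ c a b + c d e := by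
  have h := hc (show a ≤ d by lia) (show e ≤ b by lia)
  have habs : |(a : ℤ) - e| + |(d : ℤ) - b| + (2 * (min (m - a) (m - e) + min (d - m) (b - m)) : ℕ)
      ≤ |(a : ℤ) - b| + |(d : ℤ) - e| := by grind
  have habs' : |(a : ℝ) - e| + |(d : ℝ) - b| +
      (2 * (min (m - a) (m - e) + min (d - m) (b - m)) : ℕ) ≤ |(a : ℝ) - b| + |(d : ℝ) - e| := by
    exact_mod_cast habs
  simp only at h
  linarith

end IsStronglyMonge

theorem rpow_add_one_sub_rpow_le {α x : ℝ} (hα : 1 ≤ α) (hx : 0 ≤ x) :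
    (x + 1) ^ α - x ^ α ≤ (x + 1 + 1) ^ α - (x + 1) ^ α := by
  have h := (convexOn_rpow hα).slope_mono_adjacent (x := x) (y := x + 1) (z := x + 1 + 1) hx
    (Set.mem_Ici.2 (by positivity)) (by simp) (by simp)
  simpa using h

/-- The excess of `|t| ^ α` over `|t|` is not convex on `ℝ`, but it is on `ℤ`, because it vanishes
at `-1`, `0` and `1`. -/
theorem monotone_increment_abs_rpow_sub_abs {α : ℝ} (hα : 1 ≤ α) :
    Monotone fun t : ℤ =>
      (|((t + 1 : ℤ) : ℝ)| ^ α - |((t + 1 : ℤ) : ℝ)|) - (|(t : ℝ)| ^ α - |(t : ℝ)|) := by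
  refine monotone_int_of_le_succ fun t => ?_
  have hα₀ : α ≠ 0 := by positivity
  obtain ht | rfl | ht : 0 ≤ t ∨ t = -1 ∨ t + 1 + 1 ≤ 0 := by lia
  · have hx : (0 : ℝ) ≤ t := Int.cast_nonneg ht
    have h := rpow_add_one_sub_rpow_le hα hx
    push_cast
    rw [abs_of_nonneg hx, abs_of_nonneg (add_nonneg hx zero_le_one),
      abs_of_nonneg (by positivity : (0 : ℝ) ≤ t + 1 + 1)]
    linarith
  · simp [hα₀]
  · have hx : (t : ℝ) + 1 + 1 ≤ 0 := by exact_mod_cast ht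
    have h := rpow_add_one_sub_rpow_le hα (neg_nonneg.2 hx)
    push_cast
    rw [abs_of_nonpos hx, abs_of_nonpos (by linarith : (t : ℝ) + 1 ≤ 0),
      abs_of_nonpos (by linarith : (t : ℝ) ≤ 0)]
    ring_nf at h ⊢
    linarith

theorem isStronglyMonge_powerCost {α : ℝ} (hα : 1 ≤ α) : IsStronglyMonge (powerCost α) := by
  simpa [IsStronglyMonge, powerCost] using
    isMonge_comp_sub (f := fun t => |(t : ℝ)| ^ α - |(t : ℝ)|)
      (monotone_increment_abs_rpow_sub_abs hα)

end Monge

section Weight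

variable {n : ℕ} {c : ℕ → ℕ → ℝ} {β : ℝ}

/-- The cost of a permutation as a matching of positions with values. -/
def matchingCost (c : ℕ → ℕ → ℝ) (π : Perm (Fin n)) : ℝ := ∑ i : Fin n, c i (π i)

/-- The unnormalized Mallows weight of a permutation, with the identity as central ranking. -/
noncomputable def weight (c : ℕ → ℕ → ℝ) (β : ℝ) (π : Perm (Fin n)) : ℝ :=
  Real.exp (-β * matchingCost c π)

theorem weight_pos (c : ℕ → ℕ → ℝ) (β : ℝ) (π : Perm (Fin n)) : 0 < weight c β π :=
  Real.exp_pos _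

theorem matchingCost_mul_swap (c : ℕ → ℕ → ℝ) (π : Perm (Fin n)) {a d : Fin n} (had : a ≠ d) :
    matchingCost c (π * swap a d) + (c a (π a) + c d (π d)) =
      matchingCost c π + (c a (π d) + c d (π a)) := by
  have hd : d ∈ univ.erase a := mem_erase.2 ⟨had.symm, mem_univ d⟩
  have split (ρ : Perm (Fin n)) : matchingCost c ρ =
      c a (ρ a) + (c d (ρ d) + ∑ i ∈ (univ.erase a).erase d, c i (ρ i)) := by
    rw [add_sum_erase _ (fun i : Fin n => c i (ρ i)) hd,
      add_sum_erase _ (fun i : Fin n => c i (ρ i)) (mem_univ a), matchingCost]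
  have rest : ∑ i ∈ (univ.erase a).erase d, c i ((π * swap a d) i) =
      ∑ i ∈ (univ.erase a).erase d, c i (π i) := by
    refine sum_congr rfl fun i hi => ?_
    rw [mem_erase, mem_erase] at hi
    rw [Perm.mul_apply, swap_apply_of_ne_of_ne hi.2.1 hi.1]
  rw [split (π * swap a d), split π, rest, Perm.mul_apply, Perm.mul_apply, swap_apply_left,
    swap_apply_right]
  ring

theorem weight_le_weight_mul_exp_pow (hβ : 0 ≤ β) {π ρ : Perm (Fin n)} {x : ℕ}
    (h : matchingCost c ρ + x ≤ matchingCost c π) :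
    weight c β π ≤ weight c β ρ * Real.exp (-β) ^ x := by
  rw [weight, weight, ← Real.exp_nat_mul, ← Real.exp_add, Real.exp_le_exp]
  nlinarith

theorem weight_le_weight_mul_swap (hc : IsMonge c) (hβ : 0 ≤ β) {π : Perm (Fin n)} {a d : Fin n}
    (had : a < d) (h : π d ≤ π a) : weight c β π ≤ weight c β (π * swap a d) := by
  have hmonge := hc (show (a : ℕ) ≤ d from had.le) (show (π d : ℕ) ≤ π a from h)
  have hswap := matchingCost_mul_swap c π had.ne
  simpa using weight_le_weight_mul_exp_pow (x := 0) hβ (by push_cast; linarith)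

/-- Charging: each `x ∈ X` is charged to the image in `Y` under one of the moves. -/
theorem sum_le_mul_sum_of_moves {P M : Type*} [Fintype M] {move : M → P → P}
    (hmove : ∀ m, Function.Injective (move m)) {w : P → ℝ} (hw : ∀ x, 0 ≤ w x) {g : P → M → ℝ}
    (hg : ∀ x m, 0 ≤ g x m) {X Y : Finset P} {B : ℝ}
    (hX : ∀ x ∈ X, ∃ m, move m x ∈ Y ∧ w x ≤ w (move m x) * g (move m x) m)
    (hY : ∀ y ∈ Y, ∑ m, g y m ≤ B) : ∑ x ∈ X, w x ≤ B * ∑ y ∈ Y, w y := by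
  classical
  have hwg (y : P) (m : M) : 0 ≤ w y * g y m := mul_nonneg (hw y) (hg y m)
  calc ∑ x ∈ X, w x
      ≤ ∑ x ∈ X, ∑ m, if move m x ∈ Y then w (move m x) * g (move m x) m else 0 := by
        refine sum_le_sum fun x hx => ?_
        obtain ⟨m, hm, hle⟩ := hX x hx
        refine hle.trans ((if_pos hm).ge.trans (single_le_sum
          (f := fun m => if move m x ∈ Y then w (move m x) * g (move m x) m else 0)
          (fun m _ => ?_) (mem_univ m)))
        exact ite_nonneg (hwg _ m) le_rfl
    _ = ∑ m, ∑ y ∈ (X.image (move m)).filter (· ∈ Y), w y * g y m := by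
        rw [sum_comm]
        refine sum_congr rfl fun m _ => ?_
        rw [sum_filter, sum_image (hmove m).injOn]
    _ ≤ ∑ m, ∑ y ∈ Y, w y * g y m :=
        sum_le_sum fun m _ => sum_le_sum_of_subset_of_nonneg
          (fun y hy => (mem_filter.1 hy).2) fun y _ _ => hwg y m
    _ = ∑ y ∈ Y, w y * ∑ m, g y m := by
        rw [sum_comm]
        exact sum_congr rfl fun y _ => (mul_sum _ _ _).symm
    _ ≤ ∑ y ∈ Y, w y * B := sum_le_sum fun y hy => mul_le_mul_of_nonneg_left (hY y hy) (hw y)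
    _ = B * ∑ y ∈ Y, w y := by rw [← sum_mul, mul_comm]

theorem sum_weight_le_of_swap {X Y : Finset (Perm (Fin n))} {g : Perm (Fin n) → Fin n → Fin n → ℝ}
    (hg : ∀ π a d, 0 ≤ g π a d) {B : ℝ}
    (hX : ∀ π ∈ X, ∃ a d, π * swap a d ∈ Y ∧
      weight c β π ≤ weight c β (π * swap a d) * g (π * swap a d) a d)
    (hY : ∀ π ∈ Y, ∑ a, ∑ d, g π a d ≤ B) :
    ∑ π ∈ X, weight c β π ≤ B * ∑ π ∈ Y, weight c β π :=
  sum_le_mul_sum_of_moves (move := fun (m : Fin n × Fin n) π => π * swap m.1 m.2)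
    (g := fun π m => g π m.1 m.2) (fun _ => mul_left_injective _)
    (fun π => (weight_pos c β π).le) (fun π m => hg π m.1 m.2)
    (fun π hπ => let ⟨a, d, h⟩ := hX π hπ; ⟨(a, d), h⟩)
    (fun π hπ => (Fintype.sum_prod_type' (g π)).trans_le (hY π hπ))

end Weight

section Arcs

variable {n : ℕ} {m : ℕ} {π : Perm (Fin n)} {a : Fin n}

/-- The positions up to the cut `m` with a value beyond it. -/
def forwardArcs (m : ℕ) (π : Perm (Fin n)) : Finset (Fin n) := {a | (a : ℕ) ≤ m ∧ m < π a}

/-- The positions beyond the cut `m` with a value up to it. -/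
def backwardArcs (m : ℕ) (π : Perm (Fin n)) : Finset (Fin n) := {a | (π a : ℕ) ≤ m ∧ m < (a : ℕ)}

theorem mem_forwardArcs : a ∈ forwardArcs m π ↔ (a : ℕ) ≤ m ∧ m < π a := by simp [forwardArcs]

theorem mem_backwardArcs : a ∈ backwardArcs m π ↔ (π a : ℕ) ≤ m ∧ m < (a : ℕ) := by
  simp [backwardArcs]

theorem card_backwardArcs (m : ℕ) (π : Perm (Fin n)) :
    #(backwardArcs m π) = #(forwardArcs m π) := by
  have himage : #{a | (π a : ℕ) ≤ m} = #{a : Fin n | (a : ℕ) ≤ m} :=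
    card_equiv π (by simp)
  have hpos := card_filter_add_card_filter_not (s := {a : Fin n | (a : ℕ) ≤ m})
    (fun a => (π a : ℕ) ≤ m)
  have hval := card_filter_add_card_filter_not (s := {a : Fin n | (π a : ℕ) ≤ m})
    (fun a => (a : ℕ) ≤ m)
  simp only [filter_filter, not_le] at hpos hval
  rw [filter_congr fun a _ => and_comm (a := (π a : ℕ) ≤ m), himage] at hval
  rw [backwardArcs, forwardArcs]
  lia

theorem exists_le_sub_of_lt_card {ι : Type*} {s : Finset ι} {f : ι → ℕ} (hf : Set.InjOn f s)
    {m h : ℕ} (hm : ∀ a ∈ s, f a ≤ m) (hs : h < #s) : ∃ a ∈ s, h ≤ m - f a := by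
  by_contra! hc
  have hcard : #s ≤ #(Ico (m + 1 - h) (m + 1)) := by
    refine card_le_card_of_injOn f (fun a ha => ?_) hf
    have := hm a ha
    have := hc a ha
    simp only [coe_Ico, Set.mem_Ico]
    lia
  rw [Nat.card_Ico] at hcard
  lia

theorem exists_distant_arcs {h : ℕ} (hπ : h + 1 < #(forwardArcs m π)) (i : Fin n) :
    ∃ a ∈ forwardArcs m π, ∃ d ∈ backwardArcs m π, a ≠ i ∧ h ≤ min (m - a) (m - π d) := by
  obtain ⟨a, ha, hha⟩ := exists_le_sub_of_lt_card (s := (forwardArcs m π).erase i)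
    Fin.val_injective.injOn (fun a ha => (mem_forwardArcs.1 (mem_of_mem_erase ha)).1)
    (show h < _ by have := pred_card_le_card_erase (s := forwardArcs m π) (a := i); lia)
  obtain ⟨d, hd, hhd⟩ := exists_le_sub_of_lt_card (s := backwardArcs m π)
    (Fin.val_injective.comp π.injective).injOn (fun d hd => (mem_backwardArcs.1 hd).1)
    (show h < _ by rw [card_backwardArcs]; lia)
  exact ⟨a, mem_of_mem_erase ha, d, hd, ne_of_mem_erase ha, le_min hha hhd⟩

/-- All `r` values in `(j - r, j]` are hit, and at most `#(backwardArcs j π) + #(forwardArcs i π)`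
of them from positions outside `(i, j]`. -/
theorem exists_mem_Ioc_of_card_add_card_lt {i j r : ℕ} (hjn : j < n) (hij : i + r ≤ j)
    (hr : #(forwardArcs i π) + #(forwardArcs j π) < r) :
    ∃ l : Fin n, i < l ∧ (l : ℕ) ≤ j ∧ j - r < (π l : ℕ) ∧ (π l : ℕ) ≤ j := by
  by_contra! hcon
  have hsub : ({l | j - r < (π l : ℕ) ∧ (π l : ℕ) ≤ j} : Finset (Fin n)) ⊆
      forwardArcs i π ∪ backwardArcs j π := by
    intro l hl
    have := hcon l
    simp only [mem_filter_univ, mem_union, mem_backwardArcs, mem_forwardArcs] at hl ⊢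
    lia
  have hhit : #(Ioc (j - r) j) ≤ #{l | j - r < (π l : ℕ) ∧ (π l : ℕ) ≤ j} := by
    refine card_le_card_of_surjOn (fun l => (π l : ℕ)) fun v hv => ?_
    simp only [coe_Ioc, Set.mem_Ioc] at hv
    exact ⟨π.symm ⟨v, by lia⟩, by simpa using hv, by simp⟩
  have hcard := (card_le_card hsub).trans (card_union_le _ _)
  rw [card_backwardArcs] at hcard
  rw [Nat.card_Ioc] at hhit
  lia

theorem card_forwardArcs_mul_swap_le {i l : Fin n} {j : ℕ} (hi : i ∈ forwardArcs j π)
    (hl : (π l : ℕ) ≤ j) : #(forwardArcs j (π * swap i l)) ≤ #(forwardArcs j π) := by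
  have hsub : forwardArcs j (π * swap i l) ⊆ insert l ((forwardArcs j π).erase i) := by
    intro a ha
    rw [mem_insert, mem_erase]
    by_cases hal : a = l
    · exact Or.inl hal
    rw [mem_forwardArcs, Perm.mul_apply] at ha
    have hai : a ≠ i := by
      rintro rfl
      rw [swap_apply_left] at ha
      lia
    rw [swap_apply_of_ne_of_ne hai hal] at ha
    exact Or.inr ⟨hai, mem_forwardArcs.2 ha⟩
  have hcard := (card_le_card hsub).trans (card_insert_le _ _)
  rwa [card_erase_add_one hi] at hcard

end Arcs

section ManyArcs

theorem sum_pow_le_inv_one_sub {ι : Type*} {s : Finset ι} {f : ι → ℕ} (hf : Set.InjOn f s) {p : ℝ}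
    (hp₀ : 0 ≤ p) (hp₁ : p < 1) : ∑ a ∈ s, p ^ f a ≤ (1 - p)⁻¹ := by
  classical
  rw [← sum_image (f := (p ^ ·)) hf, ← tsum_geometric_of_lt_one hp₀ hp₁]
  exact (summable_geometric_of_lt_one hp₀ hp₁).sum_le_tsum _ fun i _ => pow_nonneg hp₀ i

theorem sum_pow_min_le_inv_one_sub {ι : Type*} {s : Finset ι} {f g : ι → ℕ} (hf : Set.InjOn f s)
    (hg : Set.InjOn g s) {p : ℝ} (hp₀ : 0 ≤ p) (hp₁ : p < 1) :
    ∑ a ∈ s, p ^ min (f a) (g a) ≤ 2 * (1 - p)⁻¹ := by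
  have pow_min_le (x y : ℕ) : p ^ min x y ≤ p ^ x + p ^ y := by
    have := pow_nonneg hp₀ x
    have := pow_nonneg hp₀ y
    rcases min_choice x y with h | h <;> rw [h] <;> linarith
  calc ∑ a ∈ s, p ^ min (f a) (g a) ≤ ∑ a ∈ s, (p ^ f a + p ^ g a) :=
        sum_le_sum fun a _ => pow_min_le _ _
    _ = ∑ a ∈ s, p ^ f a + ∑ a ∈ s, p ^ g a := sum_add_distrib
    _ ≤ 2 * (1 - p)⁻¹ := by
        linarith [sum_pow_le_inv_one_sub hf hp₀ hp₁, sum_pow_le_inv_one_sub hg hp₀ hp₁]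

variable {n : ℕ} {c : ℕ → ℕ → ℝ} {β p : ℝ}

/-- The charge of an arc that does not cross the cut `m` from the left: geometric in the distance
of the nearer end to the cut. -/
noncomputable def leftCharge (p : ℝ) (m : ℕ) (π : Perm (Fin n)) (a : Fin n) : ℝ :=
  if (a : ℕ) ≤ m ∧ (π a : ℕ) ≤ m then p ^ min (m - a : ℕ) (m - π a) else 0

/-- The mirror image of `leftCharge`, for the arcs on the right of the cut. -/
noncomputable def rightCharge (p : ℝ) (m : ℕ) (π : Perm (Fin n)) (d : Fin n) : ℝ :=
  if m < (d : ℕ) ∧ m < (π d : ℕ) then p ^ min (d - m : ℕ) (π d - m) else 0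

theorem leftCharge_nonneg (hp₀ : 0 ≤ p) (m : ℕ) (π : Perm (Fin n)) (a : Fin n) :
    0 ≤ leftCharge p m π a :=
  ite_nonneg (pow_nonneg hp₀ _) le_rfl

theorem rightCharge_nonneg (hp₀ : 0 ≤ p) (m : ℕ) (π : Perm (Fin n)) (d : Fin n) :
    0 ≤ rightCharge p m π d :=
  ite_nonneg (pow_nonneg hp₀ _) le_rfl

theorem sum_leftCharge_le (hp₀ : 0 ≤ p) (hp₁ : p < 1) (m : ℕ) (π : Perm (Fin n)) :
    ∑ a, leftCharge p m π a ≤ 2 * (1 - p)⁻¹ := by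
  simp only [leftCharge, ← sum_filter]
  refine sum_pow_min_le_inv_one_sub (fun a ha b hb hab => ?_) (fun a ha b hb hab => ?_) hp₀ hp₁ <;>
    simp only [coe_filter_univ, Set.mem_ofPred_eq] at ha hb hab
  · exact Fin.ext (by lia)
  · exact π.injective (Fin.ext (by lia))

theorem sum_rightCharge_le (hp₀ : 0 ≤ p) (hp₁ : p < 1) (m : ℕ) (π : Perm (Fin n)) :
    ∑ d, rightCharge p m π d ≤ 2 * (1 - p)⁻¹ := by
  simp only [rightCharge, ← sum_filter]
  refine sum_pow_min_le_inv_one_sub (fun a ha b hb hab => ?_) (fun a ha b hb hab => ?_) hp₀ hp₁ <;>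
    simp only [coe_filter_univ, Set.mem_ofPred_eq] at ha hb hab
  · exact Fin.ext (by lia)
  · exact π.injective (Fin.ext (by lia))

theorem weight_le_weight_uncross (hc : IsStronglyMonge c) (hβ : 0 ≤ β) {m : ℕ} {π : Perm (Fin n)}
    {a d : Fin n} (ha : a ∈ forwardArcs m π) (hd : d ∈ backwardArcs m π) {h : ℕ}
    (hh : h ≤ min (m - a) (m - π d)) :
    weight c β π ≤ weight c β (π * swap a d) * (Real.exp (-β) ^ h *
      (leftCharge (Real.exp (-β)) m (π * swap a d) a *
        rightCharge (Real.exp (-β)) m (π * swap a d) d)) := by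
  rw [mem_forwardArcs] at ha
  rw [mem_backwardArcs] at hd
  have had : a ≠ d := by rintro rfl; lia
  have hswap := matchingCost_mul_swap c π had
  have huncross := hc.uncross ha.1 hd.1 ha.2 hd.2
  refine (weight_le_weight_mul_exp_pow hβ (by linarith)).trans
    (mul_le_mul_of_nonneg_left ?_ (weight_pos c β _).le)
  simp only [leftCharge, rightCharge, Perm.mul_apply, swap_apply_left, swap_apply_right]
  rw [if_pos ⟨ha.1, hd.1⟩, if_pos ⟨hd.2, ha.2⟩, ← pow_add, ← pow_add]
  exact pow_le_pow_of_le_one (Real.exp_pos _).le (Real.exp_le_one_iff.2 (by linarith)) (by lia)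

/-- Many arcs over a cut are unlikely, even given the value of one position `i`: some forward arc
not at `i` and some backward arc are far from the cut, and uncrossing them is cheap. -/
theorem sum_weight_many_arcs_le (hc : IsStronglyMonge c) (hβ : 0 < β) {i : Fin n}
    (Q : Fin n → Prop) [DecidablePred Q] {m : ℕ} (him : (i : ℕ) ≤ m) (h : ℕ) :
    ∑ π : Perm (Fin n) with Q (π i) ∧ h + 1 < #(forwardArcs m π), weight c β π ≤
      Real.exp (-β) ^ h * (2 * (1 - Real.exp (-β))⁻¹) ^ 2 *
        ∑ π : Perm (Fin n) with Q (π i), weight c β π := by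
  set p := Real.exp (-β)
  have hp₀ : 0 ≤ p := (Real.exp_pos _).le
  have hp₁ : p < 1 := Real.exp_lt_one_iff.2 (by linarith)
  refine sum_weight_le_of_swap
    (g := fun π a d => p ^ h * (leftCharge p m π a * rightCharge p m π d)) (fun π a d => ?_)
    (fun π hπ => ?_) fun π _ => ?_
  · exact mul_nonneg (pow_nonneg hp₀ h)
      (mul_nonneg (leftCharge_nonneg hp₀ m π a) (rightCharge_nonneg hp₀ m π d))
  · rw [mem_filter_univ] at hπ
    obtain ⟨a, ha, d, hd, hai, hh⟩ := exists_distant_arcs hπ.2 i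
    refine ⟨a, d, ?_, weight_le_weight_uncross hc hβ.le ha hd hh⟩
    have hid : i ≠ d := by
      rintro rfl
      exact (mem_backwardArcs.1 hd).2.not_ge him
    rw [mem_filter_univ, Perm.mul_apply, swap_apply_of_ne_of_ne hai.symm hid]
    exact hπ.1
  · have : 0 ≤ 2 * (1 - p)⁻¹ := by
      have := sub_pos.2 hp₁
      positivity
    calc ∑ a, ∑ d, p ^ h * (leftCharge p m π a * rightCharge p m π d)
        = p ^ h * ((∑ a, leftCharge p m π a) * ∑ d, rightCharge p m π d) := by
          rw [sum_mul_sum]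
          simp only [mul_sum]
      _ ≤ p ^ h * (2 * (1 - p)⁻¹) ^ 2 := by
          rw [sq]
          gcongr
          · exact sum_nonneg fun d _ => rightCharge_nonneg hp₀ m π d
          · exact sum_leftCharge_le hp₀ hp₁ m π
          · exact sum_rightCharge_le hp₀ hp₁ m π

end ManyArcs

section Tail

variable {n : ℕ} {c : ℕ → ℕ → ℝ} {β : ℝ}

/-- If few arcs cross the cuts at `i` and at `j`, then the long arc from `i` can be exchanged with
an arc that ends at most `2 * h + 1` before `j`; the exchange is undone by one of at most `h`
transpositions. -/
theorem sum_weight_few_arcs_le (hc : IsMonge c) (hβ : 0 ≤ β) (i : Fin n) {h j : ℕ}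
    (hj : (i : ℕ) + (2 * h + 1) ≤ j) :
    ∑ π : Perm (Fin n) with j < (π i : ℕ) ∧ #(forwardArcs i π) ≤ h ∧ #(forwardArcs j π) ≤ h,
        weight c β π ≤
      h * ∑ π : Perm (Fin n) with j - (2 * h + 1) < (π i : ℕ) ∧ (π i : ℕ) ≤ j, weight c β π := by
  classical
  set Y : Finset (Perm (Fin n)) :=
    {π | (j - (2 * h + 1) < (π i : ℕ) ∧ (π i : ℕ) ≤ j) ∧ #(forwardArcs j π) ≤ h} with hY
  have hYsub : ∑ π ∈ Y, weight c β π ≤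
      ∑ π : Perm (Fin n) with j - (2 * h + 1) < (π i : ℕ) ∧ (π i : ℕ) ≤ j, weight c β π :=
    sum_le_sum_of_subset_of_nonneg (monotone_filter_right _ fun π _ hπ => hπ.1)
      fun π _ _ => (weight_pos c β π).le
  refine le_trans ?_ (mul_le_mul_of_nonneg_left hYsub (Nat.cast_nonneg h))
  refine sum_weight_le_of_swap
    (g := fun π a l => if a = i ∧ l ∈ forwardArcs j π then 1 else 0)
    (fun π a l => ite_nonneg zero_le_one le_rfl) (fun π hπ => ?_) fun π hπ => ?_
  · rw [mem_filter_univ] at hπ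
    obtain ⟨hij, hi, hjc⟩ := hπ
    obtain ⟨l, hil, hlj, hl⟩ := exists_mem_Ioc_of_card_add_card_lt (hij.trans (π i).2) hj
      (show #(forwardArcs i π) + #(forwardArcs j π) < 2 * h + 1 by lia)
    have hl_mem : l ∈ forwardArcs j (π * swap i l) := by
      rw [mem_forwardArcs, Perm.mul_apply, swap_apply_right]
      exact ⟨hlj, hij⟩
    refine ⟨i, l, ?_, ?_⟩
    · rw [hY, mem_filter_univ, Perm.mul_apply, swap_apply_left]
      exact ⟨hl, (card_forwardArcs_mul_swap_le (mem_forwardArcs.2 ⟨by lia, hij⟩) hl.2).trans hjc⟩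
    · rw [if_pos ⟨rfl, hl_mem⟩, mul_one]
      exact weight_le_weight_mul_swap hc hβ hil (Fin.le_def.2 (by lia))
  · rw [hY, mem_filter_univ] at hπ
    rw [sum_eq_single i (fun a _ ha => by simp [ha]) (by simp)]
    simpa using hπ.2

/-- The total weight of the permutations that move `i` beyond `j`. -/
noncomputable def tailWeight (c : ℕ → ℕ → ℝ) (β : ℝ) (i : Fin n) (j : ℕ) : ℝ :=
  ∑ π : Perm (Fin n) with j < (π i : ℕ), weight c β π

theorem tailWeight_eq_add {j j' : ℕ} (hj : j' ≤ j) (i : Fin n) :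
    tailWeight c β i j' = tailWeight c β i j +
      ∑ π : Perm (Fin n) with j' < (π i : ℕ) ∧ (π i : ℕ) ≤ j, weight c β π := by
  rw [tailWeight, ← sum_filter_add_sum_filter_not _ (fun π : Perm (Fin n) => j < (π i : ℕ)),
    filter_filter, filter_filter, tailWeight]
  simp only [not_lt]
  congr 2
  exact filter_congr fun π _ => by lia

theorem tailWeight_le_add_add (c : ℕ → ℕ → ℝ) (β : ℝ) (i : Fin n) (j h : ℕ) :
    tailWeight c β i j ≤
      ∑ π : Perm (Fin n) with j < (π i : ℕ) ∧ h < #(forwardArcs i π), weight c β π +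
      ∑ π : Perm (Fin n) with j < (π i : ℕ) ∧ h < #(forwardArcs j π), weight c β π +
      ∑ π : Perm (Fin n) with j < (π i : ℕ) ∧ #(forwardArcs i π) ≤ h ∧ #(forwardArcs j π) ≤ h,
        weight c β π := by
  simp only [tailWeight, sum_filter, ← sum_add_distrib]
  refine sum_le_sum fun π _ => ?_
  have := weight_pos c β π
  split_ifs <;> first | linarith | lia

theorem tailWeight_contract (hc : IsStronglyMonge c) (hβ : 0 < β) {h : ℕ}
    (hh : Real.exp (-β) ^ h * (2 * (1 - Real.exp (-β))⁻¹) ^ 2 ≤ 1 / 4) (i : Fin n) (j : ℕ) :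
    tailWeight c β i (i + j + (2 * (h + 1) + 1)) ≤
      (h + 1) / (h + 1 + 1 / 2) * tailWeight c β i (i + j) := by
  set j' := i + j + (2 * (h + 1) + 1) with hj'
  have hnonneg : 0 ≤ tailWeight c β i j' := sum_nonneg fun π _ => (weight_pos c β π).le
  have many {m : ℕ} (hm : (i : ℕ) ≤ m) :
      ∑ π : Perm (Fin n) with j' < (π i : ℕ) ∧ h + 1 < #(forwardArcs m π), weight c β π ≤
        1 / 4 * tailWeight c β i j' :=
    (sum_weight_many_arcs_le hc hβ (fun v => j' < (v : ℕ)) hm h).trans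
      (mul_le_mul_of_nonneg_right hh hnonneg)
  have few := sum_weight_few_arcs_le (c := c) hc.isMonge hβ.le i (h := h + 1) (j := j') (by lia)
  rw [hj', Nat.add_sub_cancel, ← hj', Nat.cast_succ] at few
  have split := tailWeight_le_add_add c β i j' (h + 1)
  rw [tailWeight_eq_add (show i + j ≤ j' by lia) i, div_mul_eq_mul_div, le_div_iff₀ (by positivity)]
  linarith [many le_rfl, many (show (i : ℕ) ≤ j' by lia)]

theorem tailWeight_le_pow (hc : IsStronglyMonge c) (hβ : 0 < β) {h : ℕ}
    (hh : Real.exp (-β) ^ h * (2 * (1 - Real.exp (-β))⁻¹) ^ 2 ≤ 1 / 4) (i : Fin n) (t : ℕ) :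
    tailWeight c β i (i + (2 * (h + 1) + 1) * t) ≤
      ((h + 1) / (h + 1 + 1 / 2)) ^ t * ∑ π : Perm (Fin n), weight c β π := by
  induction t with
  | zero =>
    rw [pow_zero, one_mul]
    exact sum_le_sum_of_subset_of_nonneg (filter_subset _ _) fun π _ _ => (weight_pos c β π).le
  | succ t ih =>
    rw [pow_succ', mul_assoc, mul_add_one, ← add_assoc]
    exact (tailWeight_contract hc hβ hh i _).trans
      (mul_le_mul_of_nonneg_left ih (by positivity))

theorem exists_tailWeight_le (hβ : 0 < β) :
    ∃ K : ℕ, ∀ c, IsStronglyMonge c → ∀ (n : ℕ) (i : Fin n) (t : ℕ),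
      tailWeight c β i (i + K * t) ≤ (1 / 2) ^ t * ∑ π : Perm (Fin n), weight c β π := by
  obtain ⟨h, hh⟩ : ∃ h : ℕ, Real.exp (-β) ^ h * (2 * (1 - Real.exp (-β))⁻¹) ^ 2 ≤ 1 / 4 := by
    have htendsto := (tendsto_pow_atTop_nhds_zero_of_lt_one (Real.exp_pos (-β)).le
      (Real.exp_lt_one_iff.2 (by linarith))).mul_const ((2 * (1 - Real.exp (-β))⁻¹) ^ 2)
    rw [zero_mul] at htendsto
    exact (htendsto.eventually_le_const (by norm_num)).exists
  obtain ⟨s, hs⟩ : ∃ s : ℕ, ((h + 1) / (h + 1 + 1 / 2) : ℝ) ^ s < 1 / 2 :=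
    exists_pow_lt_of_lt_one (by norm_num) ((div_lt_one (by positivity)).2 (by linarith))
  refine ⟨(2 * (h + 1) + 1) * s, fun c hc n i t => ?_⟩
  rw [mul_assoc]
  refine (tailWeight_le_pow hc hβ hh i (s * t)).trans (mul_le_mul_of_nonneg_right ?_
    (sum_nonneg fun π _ => (weight_pos c β π).le))
  rw [pow_mul]
  exact pow_le_pow_left₀ (by positivity) hs.le t

end Tail

section Band

variable {n : ℕ} {c : ℕ → ℕ → ℝ} {β : ℝ}

/-- No position is moved by more than `k`. -/
def InBand (k : ℕ) (π : Perm (Fin n)) : Prop :=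
  ∀ i : Fin n, (i : ℕ) ≤ π i + k ∧ (π i : ℕ) ≤ i + k

instance (k : ℕ) : DecidablePred (InBand k : Perm (Fin n) → Prop) := fun π => by
  unfold InBand
  infer_instance

theorem weight_inv (c : ℕ → ℕ → ℝ) (β : ℝ) (π : Perm (Fin n)) :
    weight c β π⁻¹ = weight (Function.swap c) β π := by
  simp only [weight, matchingCost]
  rw [← Equiv.sum_comp π]
  simp [Function.swap]

theorem sum_weight_lt_inv_apply (c : ℕ → ℕ → ℝ) (β : ℝ) (i : Fin n) (j : ℕ) :
    ∑ π : Perm (Fin n) with j < (π⁻¹ i : ℕ), weight c β π =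
      tailWeight (Function.swap c) β i j := by
  rw [tailWeight, sum_filter, sum_filter, ← Equiv.sum_comp (Equiv.inv (Perm (Fin n)))]
  simp [weight_inv]

theorem exists_lt_apply_of_not_inBand {k : ℕ} {π : Perm (Fin n)} (h : ¬ InBand k π) :
    ∃ i : Fin n, (i : ℕ) + k < π i ∨ (i : ℕ) + k < π⁻¹ i := by
  rw [InBand, not_forall] at h
  obtain ⟨i, hi⟩ := h
  rcases not_and_or.1 hi with hi | hi
  · exact ⟨π i, Or.inr (by simpa using hi)⟩
  · exact ⟨i, Or.inl (not_le.1 hi)⟩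

theorem sum_weight_not_inBand_le (c : ℕ → ℕ → ℝ) (β : ℝ) (n k : ℕ) :
    ∑ π : Perm (Fin n) with ¬ InBand k π, weight c β π ≤
      ∑ i : Fin n, (tailWeight c β i (i + k) + tailWeight (Function.swap c) β i (i + k)) := by
  simp only [← sum_weight_lt_inv_apply]
  simp only [tailWeight, sum_filter, ← sum_add_distrib]
  rw [sum_comm]
  refine sum_le_sum fun π _ => ?_
  have hw := (weight_pos c β π).le
  have hterm (i : Fin n) : 0 ≤ (if (i : ℕ) + k < π i then weight c β π else 0) +
      (if (i : ℕ) + k < π⁻¹ i then weight c β π else 0) :=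
    add_nonneg (ite_nonneg hw le_rfl) (ite_nonneg hw le_rfl)
  split_ifs with hπ
  · exact sum_nonneg fun i _ => hterm i
  · obtain ⟨i, hi⟩ := exists_lt_apply_of_not_inBand hπ
    refine le_trans ?_ (single_le_sum (fun i _ => hterm i) (mem_univ i))
    split_ifs <;> first | linarith | lia

theorem exists_sum_weight_not_inBand_le (hβ : 0 < β) :
    ∃ K : ℕ, ∀ c, IsStronglyMonge c → ∀ n t : ℕ,
      ∑ π : Perm (Fin n) with ¬ InBand (K * t) π, weight c β π ≤
        2 * n * (1 / 2) ^ t * ∑ π : Perm (Fin n), weight c β π := by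
  obtain ⟨K, hK⟩ := exists_tailWeight_le hβ
  refine ⟨K, fun c hc n t => (sum_weight_not_inBand_le c β n (K * t)).trans ?_⟩
  have hswap : ∑ π : Perm (Fin n), weight (Function.swap c) β π =
      ∑ π : Perm (Fin n), weight c β π := by
    simp only [← weight_inv]
    exact Equiv.sum_comp (Equiv.inv _) _
  calc ∑ i : Fin n, (tailWeight c β i (i + K * t) + tailWeight (Function.swap c) β i (i + K * t))
      ≤ ∑ i : Fin n, 2 * ((1 / 2) ^ t * ∑ π : Perm (Fin n), weight c β π) := by
        refine sum_le_sum fun i _ => ?_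
        have hright := hK c hc n i t
        have hleft := hK _ hc.swap n i t
        rw [hswap] at hleft
        linarith
    _ = 2 * n * (1 / 2) ^ t * ∑ π : Perm (Fin n), weight c β π := by
        rw [sum_const, card_univ, Fintype.card_fin, nsmul_eq_mul]
        ring

end Band

section Truncation

theorem tvDist_le_of_mul_le {Ω : Type*} [Fintype Ω] {p q : PMF Ω} {δ : ℝ}
    (h : ∀ a, (1 - δ) * (p a).toReal ≤ (q a).toReal) : tvDist p q ≤ δ := by
  have sum_toReal (r : PMF Ω) : ∑ a, (r a).toReal = 1 := by
    rw [← ENNReal.toReal_sum fun a _ => r.apply_ne_top a, ← ENNReal.toReal_one, ← r.tsum_coe,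
      tsum_fintype]
  have hδ : 0 ≤ δ := by
    have := sum_le_sum fun a (_ : a ∈ univ) => h a
    rw [← mul_sum, sum_toReal, sum_toReal] at this
    linarith
  have hpoint (a : Ω) : |(p a).toReal - (q a).toReal| ≤
      2 * δ * (p a).toReal - ((p a).toReal - (q a).toReal) := by
    have hδp := mul_nonneg hδ (p a).toReal_nonneg
    have := h a
    exact abs_le.2 ⟨by linarith, by linarith⟩
  calc tvDist p q
      ≤ 1 / 2 * ∑ a, (2 * δ * (p a).toReal - ((p a).toReal - (q a).toReal)) :=
        mul_le_mul_of_nonneg_left (sum_le_sum fun a _ => hpoint a) (by norm_num)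
    _ = δ := by
        rw [sum_sub_distrib, sum_sub_distrib, ← mul_sum, sum_toReal, sum_toReal]
        ring

section ProportionalTo

variable {Ω : Type*} [Fintype Ω] {v w : Ω → ℝ} {δ : ℝ}

theorem proportionalTo_apply (h : ∃ a, 0 < w a) (hw : ∀ a, 0 ≤ w a) (a : Ω) :
    proportionalTo w h a = ENNReal.ofReal (w a / ∑ b, w b) := by
  have hs : 0 < ∑ b, w b := Fintype.sum_pos (Pi.lt_def.2 ⟨hw, h⟩)
  rw [proportionalTo, PMF.normalize_apply, tsum_fintype,
    ← ENNReal.ofReal_sum_of_nonneg fun a _ => hw a, ENNReal.ofReal_div_of_pos hs, div_eq_mul_inv]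

theorem tvDist_proportionalTo_le (h : ∃ a, 0 < w a) (h' : ∃ a, 0 < v a) (hw : ∀ a, 0 ≤ w a)
    (hwv : ∀ a, w a ≤ v a) (hsum : (1 - δ) * ∑ a, v a ≤ ∑ a, w a) :
    tvDist (proportionalTo w h) (proportionalTo v h') ≤ δ := by
  have hv (a : Ω) : 0 ≤ v a := (hw a).trans (hwv a)
  have hW : 0 < ∑ a, w a := Fintype.sum_pos (Pi.lt_def.2 ⟨hw, h⟩)
  have hV : 0 < ∑ a, v a := Fintype.sum_pos (Pi.lt_def.2 ⟨hv, h'⟩)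
  refine tvDist_le_of_mul_le fun a => ?_
  rw [proportionalTo_apply h hw, proportionalTo_apply h' hv,
    ENNReal.toReal_ofReal (div_nonneg (hw a) hW.le),
    ENNReal.toReal_ofReal (div_nonneg (hv a) hV.le), mul_div_assoc', div_le_div_iff₀ hW hV]
  calc (1 - δ) * w a * ∑ b, v b = w a * ((1 - δ) * ∑ b, v b) := by ring
    _ ≤ w a * ∑ b, w b := mul_le_mul_of_nonneg_left hsum (hw a)
    _ ≤ v a * ∑ b, w b := mul_le_mul_of_nonneg_right (hwv a) hW.le

end ProportionalTo

theorem sum_prod_apply_apply_eq_permanent {ι R : Type*} [Fintype ι] [DecidableEq ι]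
    [CommSemiring R] (A : Matrix ι ι R) (σ : Perm ι) :
    ∑ π : Perm ι, ∏ i, A (σ i) (π i) = A.permanent := by
  refine Fintype.sum_equiv ((Equiv.inv (Perm ι)).trans (Equiv.mulLeft σ)) _ _ fun π => ?_
  rw [← Equiv.prod_comp π fun i => A _ i]
  simp

variable {n : ℕ}

theorem bandMatrix_apply (α β : ℝ) (k : ℕ) (i j : Fin n) :
    bandMatrix n α β k i j =
      if (i : ℕ) ≤ j + k ∧ (j : ℕ) ≤ i + k then Real.exp (-β * powerCost α i j) else 0 := by
  refine if_congr ?_ rfl rfl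
  rw [abs_sub_le_iff, sub_le_iff_le_add', sub_le_iff_le_add']
  norm_cast

theorem prod_bandMatrix (α β : ℝ) (k : ℕ) (π : Perm (Fin n)) :
    ∏ i, bandMatrix n α β k i (π i) = if InBand k π then weight (powerCost α) β π else 0 := by
  simp only [bandMatrix_apply]
  split_ifs with h
  · rw [prod_congr rfl fun i _ => if_pos (h i), ← Real.exp_sum, weight, matchingCost, mul_sum]
  · rw [InBand, not_forall] at h
    obtain ⟨i, hi⟩ := h
    exact prod_eq_zero (mem_univ i) (if_neg hi)

theorem prod_bandMatrix_apply_apply (α β : ℝ) (k : ℕ) (σ π : Perm (Fin n)) :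
    ∏ i, bandMatrix n α β k (σ i) (π i) =
      ∏ i, bandMatrix n α β k i ((π * σ⁻¹) i) := by
  rw [← Equiv.prod_comp σ fun i => bandMatrix n α β k i ((π * σ⁻¹) i)]
  simp

theorem exp_neg_mul_dist (α β : ℝ) (π σ : Perm (Fin n)) :
    Real.exp (-β * dist α π σ) = weight (powerCost α) β (π * σ⁻¹) := by
  rw [weight, matchingCost, ← Equiv.sum_comp σ]
  simp [dist, powerCost, abs_sub_comm]

theorem prod_bandMatrix_nonneg (α β : ℝ) (k : ℕ) (σ π : Perm (Fin n)) :
    0 ≤ ∏ i, bandMatrix n α β k (σ i) (π i) :=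
  prod_nonneg fun _ _ => ite_nonneg (Real.exp_pos _).le le_rfl

theorem prod_bandMatrix_le_exp (α β : ℝ) (k : ℕ) (σ π : Perm (Fin n)) :
    ∏ i, bandMatrix n α β k (σ i) (π i) ≤ Real.exp (-β * dist α π σ) := by
  rw [prod_bandMatrix_apply_apply, prod_bandMatrix, exp_neg_mul_dist]
  split_ifs
  exacts [le_rfl, (weight_pos _ _ _).le]

theorem permanent_bandMatrix (n : ℕ) (α β : ℝ) (k : ℕ) :
    (bandMatrix n α β k).permanent =
      ∑ π : Perm (Fin n) with InBand k π, weight (powerCost α) β π := by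
  rw [← sum_prod_apply_apply_eq_permanent _ 1, sum_filter]
  exact sum_congr rfl fun π _ => prod_bandMatrix α β k π

theorem permanent_bandMatrix_pos (n : ℕ) (α β : ℝ) (k : ℕ) :
    0 < (bandMatrix n α β k).permanent := by
  rw [permanent_bandMatrix]
  exact sum_pos (fun π _ => weight_pos _ _ _) ⟨1, mem_filter.2 ⟨mem_univ _, fun i => by simp⟩⟩

theorem partitionFunction_eq_sum_weight (α β : ℝ) (σ : Perm (Fin n)) :
    partitionFunction α β σ = ∑ π : Perm (Fin n), weight (powerCost α) β π := by
  simp only [partitionFunction, exp_neg_mul_dist]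
  exact Equiv.sum_comp (Equiv.mulRight σ⁻¹) _

theorem permanent_bandMatrix_le (α β : ℝ) (k : ℕ) (σ : Perm (Fin n)) :
    (bandMatrix n α β k).permanent ≤ partitionFunction α β σ := by
  rw [permanent_bandMatrix, partitionFunction_eq_sum_weight]
  exact sum_le_sum_of_subset_of_nonneg (filter_subset _ _) fun π _ _ => (weight_pos _ _ π).le

theorem le_permanent_bandMatrix {α β δ : ℝ} {k : ℕ} (σ : Perm (Fin n))
    (h : ∑ π : Perm (Fin n) with ¬ InBand k π, weight (powerCost α) β π ≤
      δ * ∑ π : Perm (Fin n), weight (powerCost α) β π) :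
    (1 - δ) * partitionFunction α β σ ≤ (bandMatrix n α β k).permanent := by
  rw [permanent_bandMatrix, partitionFunction_eq_sum_weight]
  have := sum_filter_add_sum_filter_not univ (fun π : Perm (Fin n) => InBand k π)
    (weight (powerCost α) β)
  linarith

theorem tvDist_truncatedMallows_le {α β δ : ℝ} {k : ℕ} (σ : Perm (Fin n))
    (h : (1 - δ) * partitionFunction α β σ ≤ (bandMatrix n α β k).permanent) :
    tvDist (truncatedMallows α β k σ) (mallows α β σ) ≤ δ := by
  refine tvDist_proportionalTo_le _ _ (prod_bandMatrix_nonneg α β k σ)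
    (prod_bandMatrix_le_exp α β k σ) ?_
  rwa [sum_prod_apply_apply_eq_permanent]

theorem truncatedMallows_apply (α β : ℝ) (k : ℕ) (σ π : Perm (Fin n)) :
    truncatedMallows α β k σ π = ENNReal.ofReal
      ((∏ i, bandMatrix n α β k i ((π * σ⁻¹) i)) / (bandMatrix n α β k).permanent) := by
  rw [truncatedMallows, proportionalTo_apply _ (prod_bandMatrix_nonneg α β k σ),
    sum_prod_apply_apply_eq_permanent, prod_bandMatrix_apply_apply]

end Truncation

section Prefix

variable {n j : ℕ}

/-- The first `j` rows. -/
def rowsBelow (n j : ℕ) : Finset (Fin n) := {i : Fin n | (i : ℕ) < j}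

/-- The rows from row `j` on. -/
def rowsFrom (n j : ℕ) : Finset (Fin n) := {i : Fin n | j ≤ (i : ℕ)}

theorem mem_rowsBelow {i : Fin n} : i ∈ rowsBelow n j ↔ (i : ℕ) < j := by simp [rowsBelow]

theorem mem_rowsFrom {i : Fin n} : i ∈ rowsFrom n j ↔ j ≤ (i : ℕ) := by simp [rowsFrom]

theorem rowsBelow_zero (n : ℕ) : rowsBelow n 0 = ∅ := by simp [rowsBelow]

theorem rowsBelow_self (n : ℕ) : rowsBelow n n = univ := by simp [rowsBelow]

theorem rowsFrom_zero (n : ℕ) : rowsFrom n 0 = univ := by simp [rowsFrom]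

theorem rowsFrom_self (n : ℕ) : rowsFrom n n = ∅ := by simp [rowsFrom]

theorem rowsBelow_succ (j : Fin n) : rowsBelow n (j + 1) = insert j (rowsBelow n j) := by
  ext i
  simp only [mem_rowsBelow, mem_insert, Fin.ext_iff]
  lia

theorem prod_rowsBelow_succ {R : Type*} [CommMonoid R] (f : Fin n → R) (j : Fin n) :
    ∏ i ∈ rowsBelow n (j + 1), f i = f j * ∏ i ∈ rowsBelow n j, f i := by
  rw [rowsBelow_succ, prod_insert (by simp [mem_rowsBelow])]

theorem prod_rowsFrom_eq_mul {R : Type*} [CommMonoid R] (f : Fin n → R) (j : Fin n) :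
    ∏ i ∈ rowsFrom n j, f i = f j * ∏ i ∈ rowsFrom n (j + 1), f i := by
  have : rowsFrom n j = insert j (rowsFrom n (j + 1)) := by
    ext i
    simp only [mem_rowsFrom, mem_insert, Fin.ext_iff]
    lia
  rw [this, prod_insert (by simp [mem_rowsFrom])]

/-- The permutations that agree with `ρ` on the first `j` rows. -/
def agreeing (j : ℕ) (ρ : Perm (Fin n)) : Finset (Perm (Fin n)) :=
  {τ | ∀ i : Fin n, (i : ℕ) < j → τ i = ρ i}

theorem mem_agreeing {ρ τ : Perm (Fin n)} :
    τ ∈ agreeing j ρ ↔ ∀ i : Fin n, (i : ℕ) < j → τ i = ρ i := by simp [agreeing]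

theorem agreeing_zero (ρ : Perm (Fin n)) : agreeing 0 ρ = univ := by simp [agreeing]

theorem agreeing_self (ρ : Perm (Fin n)) : agreeing n ρ = {ρ} := by
  ext τ
  simp [mem_agreeing, Equiv.ext_iff]

theorem swap_mul_mem_agreeing {ρ : Perm (Fin n)} {j c : Fin n} (hc : ∀ i < j, ρ i ≠ c) :
    swap (ρ j) c * ρ ∈ agreeing j ρ := by
  refine mem_agreeing.2 fun i hi => ?_
  exact swap_apply_of_ne_of_ne (ρ.injective.ne (Fin.ne_of_lt hi)) (hc i hi)

theorem filter_agreeing_eq {ρ : Perm (Fin n)} {j c : Fin n} (hc : ∀ i < j, ρ i ≠ c) :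
    {τ ∈ agreeing j ρ | τ j = c} = agreeing (j + 1) (swap (ρ j) c * ρ) := by
  have hbelow := mem_agreeing.1 (swap_mul_mem_agreeing hc)
  have hj : (swap (ρ j) c * ρ) j = c := swap_apply_left _ _
  ext τ
  rw [mem_filter, mem_agreeing, mem_agreeing]
  constructor
  · rintro ⟨h, h'⟩ i hi
    rcases Nat.lt_succ_iff_lt_or_eq.1 hi with hi | hi
    · rw [hbelow i hi, h i hi]
    · rw [Fin.ext hi, hj, h']
  · exact fun h => ⟨fun i hi => (h i (by lia)).trans (hbelow i hi), (h j (by lia)).trans hj⟩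

theorem sum_agreeing_prod_rowsFrom {R : Type*} [CommSemiring R] (A : Matrix (Fin n) (Fin n) R)
    (ρ : Perm (Fin n)) (j : Fin n) :
    ∑ τ ∈ agreeing j ρ, ∏ i ∈ rowsFrom n j, A i (τ i) =
      ∑ c : Fin n with ∀ i < j, ρ i ≠ c, A j c *
        ∑ τ ∈ agreeing (j + 1) (swap (ρ j) c * ρ), ∏ i ∈ rowsFrom n (j + 1), A i (τ i) := by
  rw [← sum_fiberwise (agreeing j ρ) (fun τ => τ j), sum_filter]
  refine sum_congr rfl fun c _ => ?_
  split_ifs with hc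
  · rw [← filter_agreeing_eq hc, mul_sum]
    refine sum_congr rfl fun τ hτ => ?_
    rw [prod_rowsFrom_eq_mul, (mem_filter.1 hτ).2]
  · push Not at hc
    obtain ⟨i, hi, rfl⟩ := hc
    refine sum_eq_zero fun τ hτ => absurd hi ?_
    obtain ⟨hτ, hτj⟩ := mem_filter.1 hτ
    rw [← mem_agreeing.1 hτ i hi] at hτj
    exact (τ.injective hτj).not_gt

end Prefix

section Mask

variable {n : ℕ}

/-- The values of the first `j` positions as a bit set: bit `c + k` stands for the value `c`.
The shift by `k` makes room for the columns of negative index that a band matrix would have. -/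
def usedMask (k j : ℕ) (τ : Perm (Fin n)) : ℕ :=
  ∑ i ∈ rowsBelow n j, 2 ^ ((τ i : ℕ) + k)

theorem usedMask_zero (k : ℕ) (τ : Perm (Fin n)) : usedMask k 0 τ = 0 := by
  simp [usedMask, rowsBelow_zero]

theorem usedMask_congr (k : ℕ) {j : ℕ} {ρ τ : Perm (Fin n)} (h : τ ∈ agreeing j ρ) :
    usedMask k j τ = usedMask k j ρ :=
  sum_congr rfl fun i hi => by rw [mem_agreeing.1 h i (mem_rowsBelow.1 hi)]

theorem testBit_usedMask (k j : ℕ) (τ : Perm (Fin n)) (b : ℕ) :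
    (usedMask k j τ).testBit b ↔ ∃ i : Fin n, (i : ℕ) < j ∧ (τ i : ℕ) + k = b := by
  have himage : usedMask k j τ =
      ∑ b ∈ (rowsBelow n j).image (fun i => (τ i : ℕ) + k), 2 ^ b := by
    rw [sum_image fun a _ b _ hab => τ.injective (Fin.ext (Nat.add_right_cancel hab)), usedMask]
  rw [← Nat.mem_bitIndices, ← List.mem_toFinset, himage, toFinset_bitIndices_sum_two_pow]
  simp [mem_rowsBelow]

theorem usedMask_succ_div {k d : ℕ} (τ : Perm (Fin n)) (j : Fin n) (hd : (j : ℕ) + d = τ j + k) :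
    usedMask k (j + 1) τ / 2 ^ ((j : ℕ) + 1) = (usedMask k j τ / 2 ^ (j : ℕ) + 2 ^ d) / 2 := by
  have hsucc : usedMask k (j + 1) τ = usedMask k j τ + 2 ^ (j : ℕ) * 2 ^ d := by
    rw [usedMask, rowsBelow_succ, sum_insert (by simp [mem_rowsBelow]), ← hd, pow_add, add_comm,
      usedMask]
  rw [hsucc, pow_succ, ← Nat.div_div_eq_div_mul, Nat.add_mul_div_left _ _ (by positivity)]

end Mask

section BandPermanent

variable {R : Type*} [CommSemiring R] {n : ℕ}

/-- The `n × n` band matrix of half-width `k` whose entry in row `i` and column `i + d - k` is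
`wt d`. -/
def toeplitzBand (n k : ℕ) (wt : ℕ → R) : Matrix (Fin n) (Fin n) R :=
  fun i j => if (i : ℕ) ≤ j + k ∧ (j : ℕ) ≤ i + k then wt (j + k - i) else 0

/-- In row `r` of a band matrix of half-width `k`, the entry with offset `d` lies in one of the
columns `0, …, n - 1` and its column is free according to `mask`. -/
def Free (n k r mask d : ℕ) : Prop := k ≤ r + d ∧ r + d + 1 ≤ n + k ∧ mask / 2 ^ d % 2 = 0

instance (n k r mask d : ℕ) : Decidable (Free n k r mask d) := by unfold Free; infer_instance

/-- The permanent of the last `e` rows of a band matrix with entries `wt d` at offset `d`, without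
the columns that are used according to `mask`. Bit `d` of `mask` stands for the column with
offset `d` in the first of these rows. -/
def bandPermanent (n k : ℕ) (wt : ℕ → R) : ℕ → ℕ → R
  | 0, _ => 1
  | e + 1, mask => ∑ d ∈ range (2 * k + 1),
      if Free n k (n - (e + 1)) mask d then wt d * bandPermanent n k wt e ((mask + 2 ^ d) / 2)
      else 0

/-- The contribution of the entry with offset `d` to the expansion of `bandPermanent` along the
first of its `e + 1` rows. -/
def rowTerm (n k : ℕ) (wt : ℕ → R) (e mask d : ℕ) : R :=
  if Free n k (n - (e + 1)) mask d then wt d * bandPermanent n k wt e ((mask + 2 ^ d) / 2) else 0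

theorem bandPermanent_succ (n k : ℕ) (wt : ℕ → R) (e mask : ℕ) :
    bandPermanent n k wt (e + 1) mask = ∑ d ∈ range (2 * k + 1), rowTerm n k wt e mask d := rfl

theorem free_usedMask_iff {k j d : ℕ} (τ : Perm (Fin n)) :
    Free n k j (usedMask k j τ / 2 ^ j) d ↔
      k ≤ j + d ∧ j + d + 1 ≤ n + k ∧ ∀ i : Fin n, (i : ℕ) < j → (τ i : ℕ) + k ≠ j + d := by
  have hbit := testBit_usedMask k j τ (j + d)
  rw [Nat.testBit_eq_decide_div_mod_eq, decide_eq_true_eq, pow_add,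
    ← Nat.div_div_eq_div_mul] at hbit
  refine and_congr_right fun _ => and_congr_right fun _ => ?_
  rw [← Nat.mod_two_ne_one, ne_eq, hbit]
  push Not
  rfl

theorem sum_free_usedMask {M : Type*} [AddCommMonoid M] (k : ℕ) (ρ : Perm (Fin n)) (j : Fin n)
    (f : ℕ → M) :
    ∑ d ∈ range (2 * k + 1) with Free n k j (usedMask k j ρ / 2 ^ (j : ℕ)) d, f d =
      ∑ c : Fin n with (∀ i < j, ρ i ≠ c) ∧ (j : ℕ) ≤ c + k ∧ (c : ℕ) ≤ j + k, f (c + k - j) := by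
  symm
  refine sum_bij (fun c _ => (c : ℕ) + k - j) ?_ ?_ ?_ fun _ _ => rfl
  · intro c hc
    rw [mem_filter_univ] at hc
    rw [mem_filter, mem_range, free_usedMask_iff]
    exact ⟨by lia, by lia, by lia, fun i hi h => hc.1 i hi (Fin.ext (by lia))⟩
  · intro c hc c' hc' h
    rw [mem_filter_univ] at hc hc'
    exact Fin.ext (by lia)
  · intro d hd
    rw [mem_filter, mem_range, free_usedMask_iff] at hd
    obtain ⟨hd, hleft, hright, hfree⟩ := hd
    refine ⟨⟨j + d - k, by lia⟩, (mem_filter_univ _).2 ⟨fun i hi h => hfree i hi ?_, ?_⟩, ?_⟩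
    · rw [h]
      exact Nat.sub_add_cancel hleft
    all_goals dsimp only; lia

theorem bandPermanent_usedMask (k : ℕ) (wt : ℕ → R) (e : ℕ) (he : e ≤ n) (ρ : Perm (Fin n)) :
    bandPermanent n k wt e (usedMask k (n - e) ρ / 2 ^ (n - e)) =
      ∑ τ ∈ agreeing (n - e) ρ, ∏ i ∈ rowsFrom n (n - e), toeplitzBand n k wt i (τ i) := by
  induction e generalizing ρ with
  | zero => simp [bandPermanent, agreeing_self, rowsFrom_self]
  | succ e ih =>
    obtain ⟨j, hj⟩ : ∃ j : Fin n, (j : ℕ) = n - (e + 1) := ⟨⟨n - (e + 1), by lia⟩, rfl⟩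
    rw [show n - e = j + 1 by lia] at ih
    rw [bandPermanent, ← hj, sum_agreeing_prod_rowsFrom, ← sum_filter, sum_free_usedMask,
      ← filter_filter, sum_filter fun c : Fin n => (j : ℕ) ≤ c + k ∧ (c : ℕ) ≤ j + k]
    refine sum_congr rfl fun c hc => ?_
    rw [mem_filter_univ] at hc
    rw [toeplitzBand, ite_mul, zero_mul]
    refine ite_congr rfl (fun hband => ?_) fun _ => rfl
    have hcj : (j : ℕ) + (c + k - j) = (swap (ρ j) c * ρ) j + k := by
      rw [Perm.mul_apply, swap_apply_left]
      lia
    rw [← ih (by lia), usedMask_succ_div _ j hcj, usedMask_congr k (swap_mul_mem_agreeing hc)]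

theorem bandPermanent_eq_permanent (n k : ℕ) (wt : ℕ → R) :
    bandPermanent n k wt n 0 = (toeplitzBand n k wt).permanent := by
  have h := bandPermanent_usedMask k wt n le_rfl 1
  rw [Nat.sub_self, usedMask_zero, Nat.zero_div, agreeing_zero, rowsFrom_zero] at h
  exact h.trans (sum_prod_apply_apply_eq_permanent _ 1)

/-- The weight at offset `d` of the band matrix of half-width `k`. -/
noncomputable def offsetWeight (α β : ℝ) (k d : ℕ) : ℝ := Real.exp (-β * powerCost α d k)

theorem offsetWeight_nonneg (α β : ℝ) (k d : ℕ) : 0 ≤ offsetWeight α β k d := (Real.exp_pos _).le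

theorem bandMatrix_eq_toeplitzBand (n : ℕ) (α β : ℝ) (k : ℕ) :
    bandMatrix n α β k = toeplitzBand n k (offsetWeight α β k) := by
  ext i j
  rw [bandMatrix_apply, toeplitzBand]
  refine ite_congr rfl (fun h => ?_) fun _ => rfl
  rw [offsetWeight, powerCost, powerCost, Nat.cast_sub h.1, Nat.cast_add, abs_sub_comm]
  ring_nf

end BandPermanent

section PMF

variable {A B : Type*}

theorem eq_of_forall_apply_le {p q : PMF A} (h : ∀ a, q a ≤ p a) : q = p := by
  ext a
  refine le_antisymm (h a) (not_lt.1 fun hlt => ?_)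
  have := ENNReal.tsum_lt_tsum (by rw [q.tsum_coe]; exact ENNReal.one_ne_top) h hlt
  rw [p.tsum_coe, q.tsum_coe] at this
  exact lt_irrefl _ this

theorem bind_congr_support (p : PMF A) {f g : A → PMF B} (h : ∀ a ∈ p.support, f a = g a) :
    p.bind f = p.bind g := by
  ext b
  rw [PMF.bind_apply, PMF.bind_apply]
  refine tsum_congr fun a => ?_
  by_cases ha : a ∈ p.support
  · rw [h a ha]
  · rw [(PMF.apply_eq_zero_iff p a).2 ha, zero_mul, zero_mul]

theorem apply_mul_apply_le_bind (p : PMF A) (f : A → PMF B) (a : A) (b : B) :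
    p a * f a b ≤ p.bind f b := by
  rw [PMF.bind_apply]
  exact ENNReal.le_tsum a

theorem le_bind_apply (p : PMF A) (f : A → PMF B) {b : B} {x : ENNReal} (h : ∀ a, x ≤ f a b) :
    x ≤ p.bind f b := by
  rw [PMF.bind_apply]
  calc x = ∑' a, p a * x := by rw [ENNReal.tsum_mul_right, p.tsum_coe, one_mul]
    _ ≤ ∑' a, p a * f a b := ENNReal.tsum_le_tsum fun a => mul_le_mul_right (h a) _

theorem apply_le_map_apply (p : PMF A) (f : A → B) (a : A) : p a ≤ p.map f (f a) := by
  rw [PMF.map_apply]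
  refine le_trans ?_ (ENNReal.le_tsum a)
  simp

theorem map_apply_of_injective (p : PMF A) {f : A → B} (hf : Function.Injective f) (a : A) :
    p.map f (f a) = p a := by
  rw [PMF.map_apply, tsum_eq_single a fun b hb => if_neg fun h => hb (hf h).symm, if_pos rfl]

/-- `l` steps of a Markov chain, from time `j` on. -/
noncomputable def chain (κ : ℕ → A → PMF A) (j : ℕ) : ℕ → A → PMF A
  | 0, a => PMF.pure a
  | l + 1, a => (κ j a).bind (chain κ (j + 1) l)

theorem chain_succ (κ : ℕ → A → PMF A) (j l : ℕ) (a : A) :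
    chain κ j (l + 1) a = (chain κ j l a).bind (κ (j + l)) := by
  induction l generalizing j a with
  | zero =>
    rw [chain, chain, PMF.pure_bind]
    exact PMF.bind_pure _
  | succ l ih =>
    rw [chain, chain, PMF.bind_bind]
    congr 1
    funext a'
    rw [ih, Nat.succ_add_eq_add_succ]

theorem chain_pure (j l : ℕ) (a : A) : chain (fun _ => PMF.pure) j l a = PMF.pure a := by
  induction l generalizing j with
  | zero => rfl
  | succ l ih => rw [chain, PMF.pure_bind, ih]

end PMF

section Reservoir

theorem coin_true {x : ℝ} (h0 : 0 ≤ x) (h1 : x ≤ 1) :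
    RealRAM.coin x true = ENNReal.ofReal x := by
  simp [RealRAM.coin, h0, h1]

theorem coin_false {x : ℝ} (h0 : 0 ≤ x) (h1 : x ≤ 1) :
    RealRAM.coin x false = ENNReal.ofReal (1 - x) := by
  simp [RealRAM.coin, h0, h1]

variable {A : Type*} {f : ℕ → ℝ}

/-- One step of reservoir sampling: with probability `f d / ∑ d' ≤ d, f d'`, the current choice is
replaced by `out d`. -/
noncomputable def reservoirStep (f : ℕ → ℝ) (out : ℕ → A) (d : ℕ) (a : A) : PMF A :=
  (RealRAM.coin (f d / ∑ d' ∈ range (d + 1), f d')).bind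
    fun b => PMF.pure (if b then out d else a)

theorem reservoirStep_of_eq_zero {d : ℕ} (hd : f d = 0) (out : ℕ → A) (a : A) :
    reservoirStep f out d a = PMF.pure a := by
  have hcoin : RealRAM.coin 0 = PMF.pure false := by
    ext b
    cases b
    · rw [coin_false le_rfl zero_le_one]
      simp
    · rw [coin_true le_rfl zero_le_one]
      simp
  rw [reservoirStep, hd, zero_div, hcoin, PMF.pure_bind]
  rfl

theorem div_sum_range_succ_mem_Icc (hf : ∀ d, 0 ≤ f d) (d : ℕ) :
    f d / ∑ d' ∈ range (d + 1), f d' ∈ Set.Icc 0 1 := by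
  have hsum : 0 ≤ ∑ d' ∈ range (d + 1), f d' := sum_nonneg fun d _ => hf d
  exact ⟨div_nonneg (hf d) hsum,
    div_le_one_of_le₀ (single_le_sum (fun d _ => hf d) (self_mem_range_succ d)) hsum⟩

theorem le_reservoirStep_replace (hf : ∀ d, 0 ≤ f d) (out : ℕ → A) (d : ℕ) (a : A) :
    ENNReal.ofReal (f d / ∑ d' ∈ range (d + 1), f d') ≤ reservoirStep f out d a (out d) := by
  obtain ⟨h0, h1⟩ := div_sum_range_succ_mem_Icc hf d
  rw [reservoirStep, ← coin_true h0 h1]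
  refine le_trans ?_ (apply_mul_apply_le_bind _ _ true _)
  simp

theorem le_reservoirStep_keep (hf : ∀ d, 0 ≤ f d) (out : ℕ → A) (d : ℕ) (a : A) :
    ENNReal.ofReal (1 - f d / ∑ d' ∈ range (d + 1), f d') ≤ reservoirStep f out d a a := by
  obtain ⟨h0, h1⟩ := div_sum_range_succ_mem_Icc hf d
  rw [reservoirStep, ← coin_false h0 h1]
  refine le_trans ?_ (apply_mul_apply_le_bind _ _ false _)
  simp

theorem div_sum_range_succ (hf : ∀ d, 0 ≤ f d) {c m : ℕ} (hc : c < m) :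
    f c / ∑ d ∈ range (m + 1), f d =
      f c / (∑ d ∈ range m, f d) * (1 - f m / ∑ d ∈ range (m + 1), f d) := by
  have hm := hf m
  have hle : f c ≤ ∑ d ∈ range m, f d := single_le_sum (fun d _ => hf d) (mem_range.2 hc)
  rw [sum_range_succ]
  rcases (hf c).eq_or_lt with h0 | h0
  · rw [← h0, zero_div, zero_div, zero_mul]
  · have hsum : 0 < ∑ d ∈ range m, f d := h0.trans_le hle
    have : 0 < ∑ d ∈ range m, f d + f m := by linarith
    field_simp
    ring

theorem le_chain_reservoirStep (hf : ∀ d, 0 ≤ f d) (out : ℕ → A) (a : A) {m c : ℕ} (hc : c < m) :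
    ENNReal.ofReal (f c / ∑ d ∈ range m, f d) ≤ chain (reservoirStep f out) 0 m a (out c) := by
  induction m with
  | zero => exact absurd hc (Nat.not_lt_zero c)
  | succ m ih =>
    rw [chain_succ, zero_add]
    rcases Nat.lt_succ_iff_lt_or_eq.1 hc with hc | rfl
    · rw [div_sum_range_succ hf hc,
        ENNReal.ofReal_mul (div_nonneg (hf c) (sum_nonneg fun d _ => hf d))]
      exact (mul_le_mul' (ih hc) (le_reservoirStep_keep hf out m (out c))).trans
        (apply_mul_apply_le_bind _ _ (out c) _)
    · exact le_bind_apply _ _ fun a' => le_reservoirStep_replace hf out c a'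

end Reservoir

section RowByRow

/-- The random choice of the column in the first of the last `e + 1` rows. The result consists of
the new mask and of the column. -/
noncomputable def rowStep (n k : ℕ) (wt : ℕ → ℝ) (e mask : ℕ) : ℕ → ℕ × ℕ → PMF (ℕ × ℕ) :=
  reservoirStep (rowTerm n k wt e mask) fun d => ((mask + 2 ^ d) / 2, n - (e + 1) + d - k)

/-- The random choice of the column of row `j`, given the mask and the previous columns. -/
noncomputable def sampleStep (n k : ℕ) (wt : ℕ → ℝ) (j : ℕ) (ω : ℕ × (ℕ → ℕ)) :
    PMF (ℕ × (ℕ → ℕ)) :=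
  (chain (rowStep n k wt (n - (j + 1)) ω.1) 0 (2 * k + 1) (0, 0)).map
    fun x => (x.1, Function.update ω.2 j x.2)

variable {n k : ℕ} {wt : ℕ → ℝ} {τ : Perm (Fin n)}

theorem bandPermanent_nonneg (n k : ℕ) (hwt : ∀ d, 0 ≤ wt d) (e mask : ℕ) :
    0 ≤ bandPermanent n k wt e mask := by
  induction e generalizing mask with
  | zero => exact zero_le_one
  | succ e ih => exact sum_nonneg fun d _ => ite_nonneg (mul_nonneg (hwt d) (ih _)) le_rfl

theorem rowTerm_nonneg (n k : ℕ) (hwt : ∀ d, 0 ≤ wt d) (e mask d : ℕ) :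
    0 ≤ rowTerm n k wt e mask d :=
  ite_nonneg (mul_nonneg (hwt d) (bandPermanent_nonneg n k hwt e _)) le_rfl

theorem rowTerm_usedMask (wt : ℕ → ℝ) (hτ : InBand k τ) (i : Fin n) :
    rowTerm n k wt (n - (i + 1)) (usedMask k i τ / 2 ^ (i : ℕ)) (τ i + k - i) =
      toeplitzBand n k wt i (τ i) *
        bandPermanent n k wt (n - (i + 1)) (usedMask k (i + 1) τ / 2 ^ ((i : ℕ) + 1)) := by
  have hoffset : (i : ℕ) + (τ i + k - i) = τ i + k := Nat.add_sub_cancel' (hτ i).1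
  rw [rowTerm, show n - (n - ((i : ℕ) + 1) + 1) = i by lia, if_pos, usedMask_succ_div τ i hoffset,
    toeplitzBand, if_pos (hτ i)]
  refine (free_usedMask_iff τ).2 ⟨by lia, by lia, fun j hj h => hj.ne ?_⟩
  exact congrArg Fin.val (τ.injective (Fin.ext (by lia)))

theorem toeplitzBand_mul_bandPermanent_le (hwt : ∀ d, 0 ≤ wt d) (hτ : InBand k τ) (i : Fin n) :
    toeplitzBand n k wt i (τ i) *
        bandPermanent n k wt (n - (i + 1)) (usedMask k (i + 1) τ / 2 ^ ((i : ℕ) + 1)) ≤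
      bandPermanent n k wt (n - i) (usedMask k i τ / 2 ^ (i : ℕ)) := by
  have hoffset : (τ i : ℕ) + k - i < 2 * k + 1 := by have := hτ i; lia
  rw [← rowTerm_usedMask wt hτ, show n - (i : ℕ) = n - (i + 1) + 1 by lia, bandPermanent_succ]
  exact single_le_sum (fun d _ => rowTerm_nonneg n k hwt _ _ d) (mem_range.2 hoffset)

/-- The values of the first `j` positions, and those of `g` for the others. -/
def firstValues (τ : Perm (Fin n)) (g : ℕ → ℕ) (j i : ℕ) : ℕ :=
  if h : i < n ∧ i < j then (τ ⟨i, h.1⟩ : ℕ) else g i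

theorem firstValues_zero (τ : Perm (Fin n)) (g : ℕ → ℕ) : firstValues τ g 0 = g := by
  funext i
  simp [firstValues]

theorem firstValues_succ (τ : Perm (Fin n)) (g : ℕ → ℕ) (j : Fin n) :
    firstValues τ g (j + 1) = Function.update (firstValues τ g j) j (τ j) := by
  funext i
  by_cases hi : i = j
  · subst hi
    simp [firstValues]
  · have : (i < n ∧ i < (j : ℕ) + 1) ↔ (i < n ∧ i < j) := by lia
    simp only [Function.update_of_ne hi, firstValues, this]

theorem le_sampleStep (hwt : ∀ d, 0 ≤ wt d) (hτ : InBand k τ) (g : ℕ → ℕ) (i : Fin n) :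
    ENNReal.ofReal (toeplitzBand n k wt i (τ i) *
        bandPermanent n k wt (n - (i + 1)) (usedMask k (i + 1) τ / 2 ^ ((i : ℕ) + 1)) /
          bandPermanent n k wt (n - i) (usedMask k i τ / 2 ^ (i : ℕ))) ≤
      sampleStep n k wt i (usedMask k i τ / 2 ^ (i : ℕ), firstValues τ g i)
        (usedMask k (i + 1) τ / 2 ^ ((i : ℕ) + 1), firstValues τ g (i + 1)) := by
  have hoffset : (i : ℕ) + (τ i + k - i) = τ i + k := Nat.add_sub_cancel' (hτ i).1
  have hsample := le_chain_reservoirStep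
    (rowTerm_nonneg n k hwt (n - (i + 1)) (usedMask k i τ / 2 ^ (i : ℕ)))
    (fun d => ((usedMask k i τ / 2 ^ (i : ℕ) + 2 ^ d) / 2, n - (n - ((i : ℕ) + 1) + 1) + d - k))
    (0, 0) (show (τ i : ℕ) + k - i < 2 * k + 1 by have := hτ i; lia)
  rw [← bandPermanent_succ, rowTerm_usedMask wt hτ, ← usedMask_succ_div τ i hoffset,
    show n - (n - ((i : ℕ) + 1) + 1) = i by lia, hoffset, Nat.add_sub_cancel,
    show n - ((i : ℕ) + 1) + 1 = n - i by lia] at hsample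
  rw [firstValues_succ, sampleStep, rowStep, show n - (n - ((i : ℕ) + 1) + 1) = i by lia]
  exact hsample.trans (apply_le_map_apply _
    (fun x : ℕ × ℕ => (x.1, Function.update (firstValues τ g i) i x.2)) _)

theorem le_chain_sampleStep (hwt : ∀ d, 0 ≤ wt d) (hZ : 0 < (toeplitzBand n k wt).permanent)
    (hτ : InBand k τ) (g : ℕ → ℕ) (j : ℕ) (hj : j ≤ n) :
    ENNReal.ofReal ((∏ i ∈ rowsBelow n j, toeplitzBand n k wt i (τ i)) *
        bandPermanent n k wt (n - j) (usedMask k j τ / 2 ^ j) /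
          (toeplitzBand n k wt).permanent) ≤
      chain (sampleStep n k wt) 0 j (0, g) (usedMask k j τ / 2 ^ j, firstValues τ g j) := by
  induction j with
  | zero =>
    rw [rowsBelow_zero, prod_empty, one_mul, usedMask_zero, Nat.zero_div, Nat.sub_zero,
      bandPermanent_eq_permanent, div_self hZ.ne', firstValues_zero, chain, PMF.pure_apply_self,
      ENNReal.ofReal_one]
  | succ j ih =>
    obtain ⟨i, rfl⟩ : ∃ i : Fin n, (i : ℕ) = j := ⟨⟨j, hj⟩, rfl⟩
    have hprod : 0 ≤ ∏ x ∈ rowsBelow n i, toeplitzBand n k wt x (τ x) :=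
      prod_nonneg fun x _ => ite_nonneg (hwt _) le_rfl
    have hrest := bandPermanent_nonneg n k hwt (n - i) (usedMask k i τ / 2 ^ (i : ℕ))
    have hterm : 0 ≤ toeplitzBand n k wt i (τ i) *
        bandPermanent n k wt (n - (i + 1)) (usedMask k (i + 1) τ / 2 ^ ((i : ℕ) + 1)) :=
      mul_nonneg (ite_nonneg (hwt _) le_rfl) (bandPermanent_nonneg n k hwt _ _)
    have hle := toeplitzBand_mul_bandPermanent_le hwt hτ i
    rw [chain_succ, zero_add]
    refine le_trans (le_trans ?_ (mul_le_mul' (ih (by lia)) (le_sampleStep hwt hτ g i)))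
      (apply_mul_apply_le_bind _ _ _ _)
    rw [← ENNReal.ofReal_mul (div_nonneg (mul_nonneg hprod hrest) hZ.le), prod_rowsBelow_succ]
    refine ENNReal.ofReal_le_ofReal (le_of_eq ?_)
    rcases hrest.eq_or_lt with h0 | h0
    · rw [mul_right_comm, le_antisymm (hle.trans h0.ge) hterm, ← h0]
      simp
    · field_simp

theorem chain_sampleStep_map (α β : ℝ) (k : ℕ) (σ : Perm (Fin n)) (g : ℕ → ℕ) :
    (chain (sampleStep n k (offsetWeight α β k)) 0 n (0, g)).map
      (fun ω (i : Fin n) => ω.2 (σ i)) = (truncatedMallows α β k σ).map values := by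
  refine (eq_of_forall_apply_le fun f => ?_).symm
  by_cases hf : f ∈ ((truncatedMallows α β k σ).map values).support
  · obtain ⟨π, -, rfl⟩ := (PMF.mem_support_map_iff _ _ _).1 hf
    have hinj : Function.Injective (values (n := n)) := fun π ρ h =>
      Equiv.ext fun i => Fin.ext (congrFun h i)
    rw [map_apply_of_injective _ hinj, truncatedMallows_apply]
    by_cases hband : InBand k (π * σ⁻¹)
    · have hZ := permanent_bandMatrix_pos n α β k
      rw [bandMatrix_eq_toeplitzBand] at hZ ⊢
      have hchain := le_chain_sampleStep (offsetWeight_nonneg α β k) hZ hband g n le_rfl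
      rw [rowsBelow_self, Nat.sub_self, bandPermanent, mul_one] at hchain
      have hvalues : values π = fun i => firstValues (π * σ⁻¹) g n (σ i) := by
        funext i
        simp [firstValues, values]
      rw [hvalues]
      exact hchain.trans (apply_le_map_apply _ (fun (ω : ℕ × (ℕ → ℕ)) (i : Fin n) => ω.2 (σ i)) _)
    · rw [prod_bandMatrix, if_neg hband]
      simp
  · rw [(PMF.apply_eq_zero_iff _ _).2 hf]
    exact zero_le

end RowByRow

end Mallows

namespace RealRAM

open Mallows Finset

section Triple

/-- Started on `s`, the programs `ps`, executed one after the other, halt within `t` steps, and the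
final memory can be coupled with a random variable of distribution `μ` such that the two are related
by `Q`. The last component of the coupling is the number of unused steps. -/
def Triple {Ω : Type} (ps : List Prog) (s : State) (t : ℕ) (μ : PMF Ω) (Q : Ω → State → Prop) :
    Prop :=
  ∃ ξ : PMF (Ω × State × ℕ), ξ.map Prod.fst = μ ∧ (∀ x ∈ ξ.support, Q x.1 x.2.1) ∧
    ∀ (r : List Prog) (N : ℕ),
      run (t + N) (ps ++ r, s) = ξ.bind fun x => run (x.2.2 + N) (r, x.2.1)

variable {Ω Ω' : Type} {p q : Prog} {ps qs : List Prog} {s : State} {t t₁ t₂ : ℕ} {μ : PMF Ω}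
  {Q : Ω → State → Prop} {R : Ω' → State → Prop}

theorem run_nil (T : ℕ) (s : State) : run T ([], s) = PMF.pure ([], s) := by
  induction T with
  | zero => rfl
  | succ T ih => rw [run, step, PMF.pure_bind, ih]

namespace Triple

theorem run_eq (h : Triple ps s t μ Q) : ∃ ξ : PMF (Ω × State × ℕ), ξ.map Prod.fst = μ ∧
    (∀ x ∈ ξ.support, Q x.1 x.2.1) ∧ run t (ps, s) = ξ.map fun x => ([], x.2.1) := by
  obtain ⟨ξ, hμ, hQ, hrun⟩ := h
  refine ⟨ξ, hμ, hQ, ?_⟩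
  have := hrun [] 0
  simp only [run_nil, List.append_nil, add_zero] at this
  exact this

theorem haltsWithin (h : Triple [p] s t μ Q) : p.HaltsWithin s t := by
  obtain ⟨ξ, -, -, hrun⟩ := h.run_eq
  intro c hc
  rw [hrun, PMF.mem_support_map_iff] at hc
  obtain ⟨x, -, rfl⟩ := hc
  rfl

theorem map_memoryAfter (h : Triple [p] s t μ Q) {A : Type} {f : State → A} {g : Ω → A}
    (hfg : ∀ ω s', Q ω s' → f s' = g ω) : (p.memoryAfter s t).map f = μ.map g := by
  obtain ⟨ξ, rfl, hQ, hrun⟩ := h.run_eq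
  rw [Prog.memoryAfter, hrun, PMF.map_comp, PMF.map_comp, PMF.map_comp]
  refine bind_congr_support ξ fun x hx => ?_
  simp only [Function.comp_apply, hfg _ _ (hQ x hx)]

theorem mono (h : Triple ps s t μ Q) {t' : ℕ} (ht : t ≤ t') {Q' : Ω → State → Prop}
    (hQQ' : ∀ ω s', Q ω s' → Q' ω s') : Triple ps s t' μ Q' := by
  obtain ⟨ξ, rfl, hQ, hrun⟩ := h
  refine ⟨ξ.map fun x => (x.1, x.2.1, x.2.2 + (t' - t)), ?_, fun x hx => ?_, fun r N => ?_⟩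
  · rw [PMF.map_comp]
    rfl
  · obtain ⟨y, hy, rfl⟩ := (PMF.mem_support_map_iff _ _ _).1 hx
    exact hQQ' _ _ (hQ y hy)
  · rw [PMF.bind_map, show t' + N = t + (t' - t + N) by lia, hrun]
    simp only [Function.comp_def, add_assoc]

theorem and_mem_support (h : Triple ps s t μ Q) :
    Triple ps s t μ fun ω s' => ω ∈ μ.support ∧ Q ω s' := by
  obtain ⟨ξ, rfl, hQ, hrun⟩ := h
  exact ⟨ξ, rfl, fun x hx => ⟨(PMF.mem_support_map_iff _ _ _).2 ⟨x, hx, rfl⟩, hQ x hx⟩, hrun⟩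

theorem map (h : Triple ps s t μ Q) (f : Ω → Ω') (hR : ∀ ω s', Q ω s' → R (f ω) s') :
    Triple ps s t (μ.map f) R := by
  obtain ⟨ξ, rfl, hQ, hrun⟩ := h
  refine ⟨ξ.map fun x => (f x.1, x.2), ?_, fun x hx => ?_, fun r N => ?_⟩
  · rw [PMF.map_comp, PMF.map_comp]
    rfl
  · obtain ⟨y, hy, rfl⟩ := (PMF.mem_support_map_iff _ _ _).1 hx
    exact hR _ _ (hQ y hy)
  · rw [hrun, PMF.bind_map]
    rfl

theorem nil (ω : Ω) (hQ : Q ω s) : Triple [] s 0 (PMF.pure ω) Q := by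
  refine ⟨PMF.pure (ω, s, 0), PMF.pure_map _ _, fun x hx => ?_, fun r N => ?_⟩
  · rwa [(PMF.mem_support_pure_iff _ _).1 hx]
  · rw [PMF.pure_bind, List.nil_append]

theorem of_step {s' : State} (hstep : ∀ r, step (ps ++ r, s) = PMF.pure (qs ++ r, s'))
    (h : Triple qs s' t μ Q) : Triple ps s (t + 1) μ Q := by
  obtain ⟨ξ, hμ, hQ, hrun⟩ := h
  refine ⟨ξ, hμ, hQ, fun r N => ?_⟩
  rw [Nat.add_right_comm, run, hstep, PMF.pure_bind, hrun]

theorem append {κ : Ω → PMF Ω'} (h₁ : Triple ps s t₁ μ Q)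
    (h₂ : ∀ ω s', Q ω s' → Triple qs s' t₂ (κ ω) R) :
    Triple (ps ++ qs) s (t₁ + t₂) (μ.bind κ) R := by
  obtain ⟨ξ, rfl, hQ, hrun⟩ := h₁
  have hcoupling : ∀ x : Ω × State × ℕ, ∃ ζ : PMF (Ω' × State × ℕ), ζ.map Prod.fst = κ x.1 ∧
      (x ∈ ξ.support → (∀ y ∈ ζ.support, R y.1 y.2.1) ∧ ∀ (r : List Prog) (N : ℕ),
        run (t₂ + N) (qs ++ r, x.2.1) = ζ.bind fun y => run (y.2.2 + N) (r, y.2.1)) := by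
    intro x
    by_cases hx : x ∈ ξ.support
    · obtain ⟨ζ, hκ, hR, hrun'⟩ := h₂ _ _ (hQ x hx)
      exact ⟨ζ, hκ, fun _ => ⟨hR, hrun'⟩⟩
    · refine ⟨(κ x.1).map fun ω => (ω, s, 0), ?_, fun h => absurd h hx⟩
      rw [PMF.map_comp]
      exact PMF.map_id _
  choose ζ hκ hζ using hcoupling
  refine ⟨ξ.bind fun x => (ζ x).map fun y => (y.1, y.2.1, y.2.2 + x.2.2), ?_, fun y hy => ?_,
    fun r N => ?_⟩
  · rw [PMF.map_bind, PMF.bind_map]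
    congr 1
    funext x
    rw [PMF.map_comp]
    exact hκ x
  · obtain ⟨x, hx, hy⟩ := (PMF.mem_support_bind_iff _ _ _).1 hy
    obtain ⟨z, hz, rfl⟩ := (PMF.mem_support_map_iff _ _ _).1 hy
    exact (hζ x hx).1 z hz
  · rw [add_assoc, List.append_assoc, hrun, PMF.bind_bind]
    refine bind_congr_support ξ fun x hx => ?_
    rw [Nat.add_left_comm, (hζ x hx).2, PMF.bind_map]
    simp only [Function.comp_def, add_assoc]

theorem skip (ω : Ω) (hQ : Q ω s) : Triple [.skip] s 1 (PMF.pure ω) Q :=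
  .of_step (fun _ => rfl) (.nil ω hQ)

theorem setNat (ω : Ω) {a : ℕ} {i x : NExpr} (hQ : Q ω (s.setNat a (i.eval s) (x.eval s))) :
    Triple [.setNat a i x] s 1 (PMF.pure ω) Q :=
  .of_step (fun _ => rfl) (.nil ω hQ)

theorem setReal (ω : Ω) {a : ℕ} {i : NExpr} {x : RExpr}
    (hQ : Q ω (s.setReal a (i.eval s) (x.eval s))) :
    Triple [.setReal a i x] s 1 (PMF.pure ω) Q :=
  .of_step (fun _ => rfl) (.nil ω hQ)

theorem seq {κ : Ω → PMF Ω'} (h₁ : Triple [p] s t₁ μ Q)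
    (h₂ : ∀ ω s', Q ω s' → Triple [q] s' t₂ (κ ω) R) :
    Triple [.seq p q] s (t₁ + t₂ + 1) (μ.bind κ) R :=
  .of_step (fun _ => rfl) (h₁.append h₂)

theorem seq_pure {ω : Ω} {ν : PMF Ω'} (h₁ : Triple [p] s t₁ (PMF.pure ω) Q)
    (h₂ : ∀ s', Q ω s' → Triple [q] s' t₂ ν R) : Triple [.seq p q] s (t₁ + t₂ + 1) ν R := by
  have := h₁.and_mem_support.seq (κ := fun _ => ν) fun ω' s' h =>
    h₂ s' ((PMF.mem_support_pure_iff _ _).1 h.1 ▸ h.2)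
  rwa [PMF.pure_bind] at this

theorem setNat_seq {a : ℕ} {i x : NExpr}
    (h : Triple [q] (s.setNat a (i.eval s) (x.eval s)) t μ Q) :
    Triple [.seq (.setNat a i x) q] s (t + 2) μ Q :=
  .of_step (qs := [.setNat a i x, q]) (fun _ => rfl) (.of_step (fun _ => rfl) h)

theorem setReal_seq {a : ℕ} {i : NExpr} {x : RExpr}
    (h : Triple [q] (s.setReal a (i.eval s) (x.eval s)) t μ Q) :
    Triple [.seq (.setReal a i x) q] s (t + 2) μ Q :=
  .of_step (qs := [.setReal a i x, q]) (fun _ => rfl) (.of_step (fun _ => rfl) h)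

theorem ite_true {b : Test} (hb : b.holds s) (h : Triple [p] s t μ Q) :
    Triple [.ite b p q] s (t + 1) μ Q :=
  .of_step (fun r => by rw [List.singleton_append, step, if_pos hb]; rfl) h

theorem ite_false {b : Test} (hb : ¬b.holds s) (h : Triple [q] s t μ Q) :
    Triple [.ite b p q] s (t + 1) μ Q :=
  .of_step (fun r => by rw [List.singleton_append, step, if_neg hb]; rfl) h

theorem flip {x : RExpr} {κ : Bool → PMF Ω} (h₁ : Triple [p] s t (κ true) Q)
    (h₂ : Triple [q] s t (κ false) Q) :
    Triple [.flip x p q] s (t + 1) ((coin (x.eval s)).bind κ) Q := by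
  have h : ∀ b : Bool, Triple [if b then p else q] s t (κ b) Q := by simpa using ⟨h₂, h₁⟩
  choose ξ hκ hQ hrun using h
  refine ⟨(coin (x.eval s)).bind ξ, ?_, fun y hy => ?_, fun r N => ?_⟩
  · rw [PMF.map_bind]
    exact congrArg _ (funext hκ)
  · obtain ⟨b, -, hy⟩ := (PMF.mem_support_bind_iff _ _ _).1 hy
    exact hQ b y hy
  · rw [Nat.add_right_comm, run, List.singleton_append, step, PMF.bind_bind, PMF.bind_bind]
    congr 1
    funext b
    rw [PMF.pure_bind]
    exact hrun b r N

theorem while_loop {b : Test} (I : ℕ → Ω → State → Prop) (κ : ℕ → Ω → PMF Ω) {c m : ℕ}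
    (hstep : ∀ j < m, ∀ ω s, I j ω s → b.holds s ∧ Triple [p] s c (κ j ω) (I (j + 1)))
    (hend : ∀ ω s, I m ω s → ¬b.holds s) {ω : Ω} (h0 : I 0 ω s) :
    Triple [.while b p] s (m * (c + 1) + 1) (chain κ 0 m ω) (I m) := by
  suffices H : ∀ l j, j + l = m → ∀ ω s, I j ω s →
      Triple [.while b p] s (l * (c + 1) + 1) (chain κ j l ω) (I m) from
    H m 0 (zero_add m) ω s h0
  intro l
  induction l with
  | zero =>
    rintro j rfl ω s h
    rw [zero_mul]
    refine .of_step (fun r => ?_) (.nil ω h)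
    rw [List.singleton_append, step, if_neg (hend ω s h)]
    rfl
  | succ l ih =>
    intro j hj ω s h
    obtain ⟨hb, hbody⟩ := hstep j (by lia) ω s h
    rw [show (l + 1) * (c + 1) + 1 = c + (l * (c + 1) + 1) + 1 by ring]
    refine .of_step (fun r => ?_) (hbody.append (ih (j + 1) (by lia)))
    rw [List.singleton_append, step, if_pos hb]
    rfl

theorem while_pure {b : Test} (I : ℕ → State → Prop) {c m : ℕ}
    (hstep : ∀ j < m, ∀ s, I j s →
      b.holds s ∧ Triple [p] s c (PMF.pure ()) fun _ => I (j + 1))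
    (hend : ∀ s, I m s → ¬b.holds s) (h0 : I 0 s) :
    Triple [.while b p] s (m * (c + 1) + 1) (PMF.pure ()) fun _ => I m := by
  rw [← chain_pure 0 m ()]
  exact while_loop (fun j _ => I j) _ (fun j hj _ => hstep j hj) (fun _ => hend) h0

end Triple

namespace State

@[simp] theorem setNat_nat_apply (s : State) (a i v a' i' : ℕ) :
    (s.setNat a i v).nat a' i' = if a' = a ∧ i' = i then v else s.nat a' i' := by
  simp only [State.setNat, Function.update_apply]
  split_ifs with h1 h2 h2 <;> simp_all

theorem setNat_nat_of_ne (s : State) {a a' : ℕ} (i v : ℕ) (ha : a' ≠ a) :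
    (s.setNat a i v).nat a' = s.nat a' :=
  Function.update_of_ne ha _ _

@[simp] theorem setNat_real (s : State) (a i v : ℕ) : (s.setNat a i v).real = s.real := rfl

@[simp] theorem setReal_real_apply (s : State) (a i : ℕ) (v : ℝ) (a' i' : ℕ) :
    (s.setReal a i v).real a' i' = if a' = a ∧ i' = i then v else s.real a' i' := by
  simp only [State.setReal, Function.update_apply]
  split_ifs with h1 h2 h2 <;> simp_all

@[simp] theorem setReal_nat (s : State) (a i : ℕ) (v : ℝ) : (s.setReal a i v).nat = s.nat := rfl

end State

end Triple

section Table

/-! Memory layout. Integer arrays: `0` holds `n`, `1` the central ranking, `2` the output, `3` the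
half-width `k`, `4` the number `2 ^ (2 * k + 1)` of masks, `5` a pointer into the table (a counter
before the table is filled), `6` an offset `d`, `7` the power `2 ^ d`, `8` the next pointer, `9` the
selected column, `10` the selected columns of all rows, `11` a counter. Real arrays: `0` holds
`α, β, ε`, `1` the output, `2` a power of two, `3` the table, `4` a sum and `5` a summand. The table
holds `bandPermanent n k (offsetWeight α β k) e mask` in cell `e * 2 ^ (2 * k + 1) + mask`. -/

/-- The integer variable in cell `0` of array `a`. -/
def nvar (a : ℕ) : NExpr := .load a (.const 0)

/-- The real variable in cell `0` of array `a`. -/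
def rvar (a : ℕ) : RExpr := .load a (.const 0)

/-- The row of the matrix that belongs to the pointer. -/
def rowExpr : NExpr := .sub (nvar 0) (.div (nvar 5) (nvar 4))

/-- The mask that belongs to the pointer. -/
def maskExpr : NExpr := .mod (nvar 5) (nvar 4)

/-- The pointer to mask `0` in the next row. -/
def nextBase : NExpr := .sub (.sub (nvar 5) maskExpr) (nvar 4)

/-- The pointer to the next row after the choice of the current offset. -/
def nextExpr : NExpr := .add nextBase (.div (.add maskExpr (nvar 7)) (.const 2))

/-- The test of `Free` at the current offset. -/
def freeTest : Test :=
  .and (.natLe (nvar 3) (.add rowExpr (nvar 6)))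
    (.and (.natLe (.add (.add rowExpr (nvar 6)) (.const 1)) (.add (nvar 0) (nvar 3)))
      (.natLe (.mod (.div maskExpr (nvar 7)) (.const 2)) (.const 0)))

/-- The distance `|d - k|` of the current offset to the diagonal, by truncated subtractions. -/
def gapExpr : RExpr := .ofNat (.add (.sub (nvar 6) (nvar 3)) (.sub (nvar 3) (nvar 6)))

/-- The weight of the current offset. The power `x ^ α` is computed as `x * exp ((α - 1) * log x)`,
which is also correct for `x = 0`. -/
def weightExpr : RExpr :=
  .exp (.sub (.ofNat (.const 0)) (.mul (.load 0 (.const 1)) (.mul gapExpr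
    (.exp (.mul (.sub (rvar 0) (.ofNat (.const 1))) (.log gapExpr))))))

/-- The value of `rowTerm` at the current offset, provided that it is free. -/
def termExpr : RExpr := .mul weightExpr (.load 3 nextExpr)

/-- The test whether the current offset is at most `2 * k`. -/
def offsetsLeft : Test :=
  .natLe (.add (nvar 6) (.const 1)) (.add (.add (nvar 3) (nvar 3)) (.const 1))

/-- Increment of the offset. -/
def nextOffset : Prog :=
  .seq (.setNat 6 (.const 0) (.add (nvar 6) (.const 1)))
    (.setNat 7 (.const 0) (.add (nvar 7) (nvar 7)))

/-- Addition of the current `rowTerm` to the sum. -/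
def addTerm : Prog :=
  .seq (.ite freeTest (.setReal 4 (.const 0) (.add (rvar 4) termExpr)) .skip) nextOffset

/-- Expansion of a partial permanent along its first row. -/
def expandRow : Prog :=
  .seq (.setReal 4 (.const 0) (.ofNat (.const 0)))
    (.seq (.setNat 6 (.const 0) (.const 0))
      (.seq (.setNat 7 (.const 0) (.const 1)) (.while offsetsLeft addTerm)))

/-- Computation of the partial permanent at the pointer. -/
def computeCell : Prog :=
  .ite (.natLe (nvar 4) (nvar 5)) expandRow (.setReal 4 (.const 0) (.ofNat (.const 1)))

/-- Computation of all partial permanents. -/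
def fillTable : Prog :=
  .seq (.setNat 5 (.const 0) (.const 0))
    (.while (.natLe (.div (nvar 5) (nvar 4)) (nvar 0))
      (.seq computeCell
        (.seq (.setReal 3 (nvar 5) (rvar 4)) (.setNat 5 (.const 0) (.add (nvar 5) (.const 1))))))

/-- The memory holds the data that filling the table and sampling leave unchanged. -/
structure Ready (n k : ℕ) (α β : ℝ) (c : ℕ → ℕ) (s : State) : Prop where
  size : s.nat 0 0 = n
  width : s.nat 3 0 = k
  masks : s.nat 4 0 = 2 ^ (2 * k + 1)
  exponent : s.real 0 0 = α
  dispersion : s.real 0 1 = β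
  center : s.nat 1 = c

/-- The first `B` cells of the table are correct. -/
def TableBelow (n k : ℕ) (α β : ℝ) (B : ℕ) (s : State) : Prop :=
  ∀ y < B, s.real 3 y =
    bandPermanent n k (offsetWeight α β k) (y / 2 ^ (2 * k + 1)) (y % 2 ^ (2 * k + 1))

/-- The row with `e` rows after it is being scanned at offset `d`, with `acc` the current sum. -/
structure Scan (n k : ℕ) (α β : ℝ) (c : ℕ → ℕ) (B e mask d : ℕ) (acc : ℝ) (s : State) : Prop where
  ready : Ready n k α β c s
  pointer : s.nat 5 0 = (e + 1) * 2 ^ (2 * k + 1) + mask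
  offset : s.nat 6 0 = d
  power : s.nat 7 0 = 2 ^ d
  sum : s.real 4 0 = acc
  table : TableBelow n k α β B s

attribute [local simp] nvar rvar NExpr.eval RExpr.eval Test.holds

variable {n k : ℕ} {α β : ℝ} {c : ℕ → ℕ} {s : State} {B e mask d : ℕ} {acc : ℝ}

theorem Ready.setNat (h : Ready n k α β c s) {a i v : ℕ} (ha : 4 < a) :
    Ready n k α β c (s.setNat a i v) where
  size := by rw [s.setNat_nat_of_ne i v (by lia), h.size]
  width := by rw [s.setNat_nat_of_ne i v (by lia), h.width]
  masks := by rw [s.setNat_nat_of_ne i v (by lia), h.masks]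
  exponent := h.exponent
  dispersion := h.dispersion
  center := by rw [s.setNat_nat_of_ne i v (by lia), h.center]

theorem Ready.setReal (h : Ready n k α β c s) {a i : ℕ} {v : ℝ} (ha : 0 < a) :
    Ready n k α β c (s.setReal a i v) where
  size := h.size
  width := h.width
  masks := h.masks
  exponent := by rw [s.setReal_real_apply, if_neg fun h => ha.ne h.1, h.exponent]
  dispersion := by rw [s.setReal_real_apply, if_neg fun h => ha.ne h.1, h.dispersion]
  center := h.center

theorem TableBelow.setReal (h : TableBelow n k α β B s) {a i : ℕ} {v : ℝ} (ha : a ≠ 3) :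
    TableBelow n k α β B (s.setReal a i v) := by
  intro y hy
  rw [s.setReal_real_apply, if_neg fun h => ha h.1.symm, h y hy]

theorem TableBelow.read (h : TableBelow n k α β B s) (hmask : mask < 2 ^ (2 * k + 1))
    (hB : (e + 1) * 2 ^ (2 * k + 1) ≤ B) :
    s.real 3 (e * 2 ^ (2 * k + 1) + mask) = bandPermanent n k (offsetWeight α β k) e mask := by
  rw [h _ (by lia), Nat.mul_add_mod_of_lt hmask, Nat.mul_comm e,
    Nat.mul_add_div (by positivity), Nat.div_eq_of_lt hmask, add_zero]

theorem mul_exp_mul_log (hα : α ≠ 0) {x : ℝ} (hx : 0 ≤ x) :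
    x * Real.exp ((α - 1) * Real.log x) = x ^ α := by
  rcases hx.eq_or_lt with rfl | h
  · rw [zero_mul, Real.zero_rpow hα]
  · rw [mul_comm (α - 1), ← Real.rpow_def_of_pos h, Real.rpow_sub_one h.ne',
      mul_div_cancel₀ _ h.ne']

theorem half_add_two_pow_lt {w : ℕ} (hmask : mask < 2 ^ w) (hd : d < w) :
    (mask + 2 ^ d) / 2 < 2 ^ w := by
  have : 2 ^ d < 2 ^ w := Nat.pow_lt_pow_right one_lt_two hd
  lia

theorem eval_gapExpr (hk : s.nat 3 0 = k) (hd : s.nat 6 0 = d) :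
    gapExpr.eval s = |(d : ℝ) - k| := by
  simp only [gapExpr, nvar, RExpr.eval, NExpr.eval, hk, hd]
  rcases le_total d k with h | h
  · rw [Nat.sub_eq_zero_of_le h, zero_add, Nat.cast_sub h, abs_sub_comm, abs_of_nonneg]
    exact sub_nonneg.2 (Nat.cast_le.2 h)
  · rw [Nat.sub_eq_zero_of_le h, add_zero, Nat.cast_sub h, abs_of_nonneg]
    exact sub_nonneg.2 (Nat.cast_le.2 h)

namespace Scan

theorem eval_weightExpr (h : Scan n k α β c B e mask d acc s) (hα : α ≠ 0) :
    weightExpr.eval s = offsetWeight α β k d := by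
  simp only [weightExpr, rvar, RExpr.eval, NExpr.eval, eval_gapExpr h.ready.width h.offset,
    h.ready.exponent, h.ready.dispersion, Nat.cast_zero, Nat.cast_one]
  rw [mul_exp_mul_log hα (abs_nonneg _), offsetWeight, powerCost, zero_sub, neg_mul]

theorem eval_maskExpr (h : Scan n k α β c B e mask d acc s) (hmask : mask < 2 ^ (2 * k + 1)) :
    maskExpr.eval s = mask := by
  simp only [maskExpr, nvar, NExpr.eval, h.pointer, h.ready.masks]
  rw [Nat.mul_add_mod_of_lt hmask]

theorem eval_rowExpr (h : Scan n k α β c B e mask d acc s) (hmask : mask < 2 ^ (2 * k + 1)) :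
    rowExpr.eval s = n - (e + 1) := by
  simp only [rowExpr, nvar, NExpr.eval, h.pointer, h.ready.masks, h.ready.size]
  rw [Nat.mul_comm, Nat.mul_add_div (by positivity), Nat.div_eq_of_lt hmask, add_zero]

theorem eval_nextBase (h : Scan n k α β c B e mask d acc s) (hmask : mask < 2 ^ (2 * k + 1)) :
    nextBase.eval s = e * 2 ^ (2 * k + 1) := by
  simp only [nextBase, NExpr.eval, h.eval_maskExpr hmask]
  simp only [nvar, NExpr.eval, h.pointer, h.ready.masks]
  rw [Nat.add_sub_cancel, Nat.succ_mul, Nat.add_sub_cancel]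

theorem eval_nextExpr (h : Scan n k α β c B e mask d acc s) (hmask : mask < 2 ^ (2 * k + 1)) :
    nextExpr.eval s = e * 2 ^ (2 * k + 1) + (mask + 2 ^ d) / 2 := by
  simp only [nextExpr, NExpr.eval, h.eval_nextBase hmask, h.eval_maskExpr hmask]
  simp only [nvar, NExpr.eval, h.power]

theorem holds_freeTest_iff (h : Scan n k α β c B e mask d acc s) (hmask : mask < 2 ^ (2 * k + 1)) :
    freeTest.holds s ↔ Free n k (n - (e + 1)) mask d := by
  simp only [freeTest, Test.holds, NExpr.eval, h.eval_rowExpr hmask, h.eval_maskExpr hmask]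
  simp only [nvar, NExpr.eval, h.power, h.offset, h.ready.width, h.ready.size, Free, Nat.le_zero]

theorem holds_offsetsLeft_iff (h : Scan n k α β c B e mask d acc s) :
    offsetsLeft.holds s ↔ d < 2 * k + 1 := by
  simp only [offsetsLeft, Test.holds, nvar, NExpr.eval, h.offset, h.ready.width]
  lia

theorem eval_termExpr (h : Scan n k α β c B e mask d acc s) (hα : α ≠ 0)
    (hmask : mask < 2 ^ (2 * k + 1)) (hd : d < 2 * k + 1) (hB : (e + 1) * 2 ^ (2 * k + 1) ≤ B)
    (hfree : Free n k (n - (e + 1)) mask d) :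
    termExpr.eval s = rowTerm n k (offsetWeight α β k) e mask d := by
  rw [termExpr, RExpr.eval, RExpr.eval, h.eval_weightExpr hα, h.eval_nextExpr hmask,
    h.table.read (half_add_two_pow_lt hmask hd) hB, rowTerm, if_pos hfree]

theorem setNat (h : Scan n k α β c B e mask d acc s) {a i v : ℕ} (ha : 7 < a) :
    Scan n k α β c B e mask d acc (s.setNat a i v) where
  ready := h.ready.setNat (by lia)
  pointer := by rw [s.setNat_nat_of_ne i v (by lia), h.pointer]
  offset := by rw [s.setNat_nat_of_ne i v (by lia), h.offset]
  power := by rw [s.setNat_nat_of_ne i v (by lia), h.power]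
  sum := h.sum
  table := h.table

theorem nextOffset (h : Scan n k α β c B e mask d acc s) :
    Scan n k α β c B e mask (d + 1) acc
      ((s.setNat 6 0 (d + 1)).setNat 7 0 (2 ^ (d + 1))) where
  ready := (h.ready.setNat (by norm_num)).setNat (by norm_num)
  pointer := by simp [h.pointer]
  offset := by simp
  power := by simp
  sum := h.sum
  table := h.table

theorem setSum (h : Scan n k α β c B e mask d acc s) (v : ℝ) :
    Scan n k α β c B e mask d v (s.setReal 4 0 v) where
  ready := h.ready.setReal (by norm_num)
  pointer := h.pointer
  offset := h.offset
  power := h.power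
  sum := by simp
  table := h.table.setReal (by norm_num)

theorem triple_nextOffset {Ω : Type} (h : Scan n k α β c B e mask d acc s) {Q : Ω → State → Prop}
    (ω : Ω) (hQ : Q ω ((s.setNat 6 0 (d + 1)).setNat 7 0 (2 ^ (d + 1)))) :
    Triple [RealRAM.nextOffset] s 3 (PMF.pure ω) Q := by
  refine .setNat_seq (.setNat ω ?_)
  simpa [h.offset, h.power, pow_succ, mul_two] using hQ

theorem triple_addTerm (hα : α ≠ 0) (hmask : mask < 2 ^ (2 * k + 1)) (hd : d < 2 * k + 1)
    (hB : (e + 1) * 2 ^ (2 * k + 1) ≤ B)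
    (h : Scan n k α β c B e mask d
      (∑ d' ∈ range d, rowTerm n k (offsetWeight α β k) e mask d') s) :
    Triple [addTerm] s 6 (PMF.pure ()) fun _ => Scan n k α β c B e mask (d + 1)
      (∑ d' ∈ range (d + 1), rowTerm n k (offsetWeight α β k) e mask d') := by
  refine .seq_pure (t₁ := 2) (Q := fun _ => Scan n k α β c B e mask d
    (∑ d' ∈ range (d + 1), rowTerm n k (offsetWeight α β k) e mask d')) (ω := ()) ?_
    fun s' h' => h'.triple_nextOffset () h'.nextOffset
  rw [sum_range_succ]
  by_cases hfree : Free n k (n - (e + 1)) mask d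
  · refine .ite_true ((h.holds_freeTest_iff hmask).2 hfree) (.setReal () ?_)
    simp only [rvar, RExpr.eval, NExpr.eval, h.eval_termExpr hα hmask hd hB hfree, h.sum]
    exact h.setSum _
  · refine .ite_false (mt (h.holds_freeTest_iff hmask).1 hfree) (.skip () ?_)
    rwa [rowTerm, if_neg hfree, add_zero]

end Scan

theorem scan_zero (hr : Ready n k α β c s)
    (hpointer : s.nat 5 0 = (e + 1) * 2 ^ (2 * k + 1) + mask) (htable : TableBelow n k α β B s) :
    Scan n k α β c B e mask 0 0 (((s.setReal 4 0 0).setNat 6 0 0).setNat 7 0 1) where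
  ready := ((hr.setReal (by norm_num)).setNat (by norm_num)).setNat (by norm_num)
  pointer := by simp [hpointer]
  offset := by simp
  power := by simp
  sum := by simp
  table := (htable.setReal (by norm_num) : TableBelow n k α β B (s.setReal 4 0 0))

theorem triple_expandRow (hα : α ≠ 0) (hmask : mask < 2 ^ (2 * k + 1))
    (hB : (e + 1) * 2 ^ (2 * k + 1) ≤ B) (hr : Ready n k α β c s)
    (hpointer : s.nat 5 0 = (e + 1) * 2 ^ (2 * k + 1) + mask) (htable : TableBelow n k α β B s) :
    Triple [expandRow] s ((2 * k + 1) * 7 + 7) (PMF.pure ()) fun _ =>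
      Scan n k α β c B e mask (2 * k + 1)
        (bandPermanent n k (offsetWeight α β k) (e + 1) mask) := by
  refine .setReal_seq (.setNat_seq (.setNat_seq (.while_pure (c := 6) (fun d =>
    Scan n k α β c B e mask d (∑ d' ∈ range d, rowTerm n k (offsetWeight α β k) e mask d'))
    (fun d hd s' h => ⟨h.holds_offsetsLeft_iff.2 hd, h.triple_addTerm hα hmask hd hB⟩)
    (fun s' h => mt h.holds_offsetsLeft_iff.1 (lt_irrefl _)) ?_)))
  simpa using scan_zero hr hpointer htable

theorem triple_computeCell (hα : α ≠ 0) {x : ℕ} (hr : Ready n k α β c s)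
    (hpointer : s.nat 5 0 = x) (htable : TableBelow n k α β x s) :
    Triple [computeCell] s ((2 * k + 1) * 7 + 8) (PMF.pure ()) fun _ s' =>
      Ready n k α β c s' ∧ s'.nat 5 0 = x ∧ TableBelow n k α β x s' ∧
        s'.real 4 0 = bandPermanent n k (offsetWeight α β k) (x / 2 ^ (2 * k + 1))
          (x % 2 ^ (2 * k + 1)) := by
  have hpos : 0 < 2 ^ (2 * k + 1) := by positivity
  by_cases hx : 2 ^ (2 * k + 1) ≤ x
  · obtain ⟨e, he⟩ := Nat.exists_eq_succ_of_ne_zero (Nat.div_pos hx hpos).ne'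
    have hdivmod : (e + 1) * 2 ^ (2 * k + 1) + x % 2 ^ (2 * k + 1) = x := by
      rw [← Nat.succ_eq_add_one, ← he, Nat.div_add_mod']
    have hexpand := triple_expandRow hα (Nat.mod_lt x hpos) (hdivmod ▸ Nat.le_add_right _ _) hr
      (hpointer.trans hdivmod.symm) htable
    rw [he]
    refine .ite_true (by simpa [hr.masks, hpointer] using hx) (hexpand.mono le_rfl fun _ s' h => ?_)
    exact ⟨h.ready, h.pointer.trans hdivmod, h.table, h.sum⟩
  · refine .mono (.ite_false (by simpa [hr.masks, hpointer] using hx) (.setReal (Q := fun _ s' =>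
      Ready n k α β c s' ∧ s'.nat 5 0 = x ∧ TableBelow n k α β x s' ∧ s'.real 4 0 = 1) ()
        ⟨hr.setReal (by norm_num), hpointer, htable.setReal (by norm_num), by simp⟩))
      (by lia) fun _ s' h => ?_
    rwa [Nat.div_eq_of_lt (not_le.1 hx)]

/-- The table is complete. -/
structure Filled (n k : ℕ) (α β : ℝ) (c : ℕ → ℕ) (s : State) : Prop where
  ready : Ready n k α β c s
  pointer : s.nat 5 0 = (n + 1) * 2 ^ (2 * k + 1)
  table : TableBelow n k α β ((n + 1) * 2 ^ (2 * k + 1)) s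

theorem triple_fillTable (hα : α ≠ 0) (hr : Ready n k α β c s) :
    Triple [fillTable] s ((n + 1) * 2 ^ (2 * k + 1) * ((2 * k + 1) * 7 + 13) + 3) (PMF.pure ())
      fun _ => Filled n k α β c := by
  have htest : ∀ x s', Ready n k α β c s' → s'.nat 5 0 = x →
      ((Test.natLe (.div (nvar 5) (nvar 4)) (nvar 0)).holds s' ↔
        x < (n + 1) * 2 ^ (2 * k + 1)) := by
    intro x s' h hx
    simp only [Test.holds, nvar, NExpr.eval, h.masks, hx, h.size]
    rw [← Nat.div_lt_iff_lt_mul (by positivity), Nat.lt_succ_iff]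
  refine .mono (.setNat_seq (.while_pure (m := (n + 1) * 2 ^ (2 * k + 1))
    (c := (2 * k + 1) * 7 + 12) (fun x s' => Ready n k α β c s' ∧ s'.nat 5 0 = x ∧
      TableBelow n k α β x s') ?_ ?_ ?_)) le_rfl fun _ s' h => ⟨h.1, h.2.1, h.2.2⟩
  · rintro x hx s' ⟨hr, hpointer, htable⟩
    refine ⟨(htest x s' hr hpointer).2 hx, .mono (.seq_pure (t₂ := 3)
      (triple_computeCell hα hr hpointer htable) ?_) (by lia) fun _ _ => id⟩
    rintro s' ⟨hr, hpointer, htable, hsum⟩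
    refine .setReal_seq (.setNat () ⟨(hr.setReal (by norm_num)).setNat (by norm_num), ?_, ?_⟩)
    · simp [hpointer]
    · intro y hy
      rcases Nat.lt_succ_iff_lt_or_eq.1 hy with hy | rfl
      · simp [hpointer, hy.ne, htable y hy]
      · simp [hpointer, hsum]
  · exact fun s' h => mt (htest _ s' h.1 h.2.1).1 (lt_irrefl _)
  · exact ⟨hr.setNat (by norm_num), by simp, fun y hy => absurd hy (Nat.not_lt_zero y)⟩

end Table

section Sampling

/-- Selection of the current offset. -/
def storeChoice : Prog :=
  .seq (.setNat 8 (.const 0) nextExpr)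
    (.setNat 9 (.const 0) (.sub (.add rowExpr (nvar 6)) (nvar 3)))

/-- Selection of the current free offset with the probability that reservoir sampling
prescribes. -/
def offerFree : Prog :=
  .seq (.setReal 5 (.const 0) termExpr)
    (.seq (.setReal 4 (.const 0) (.add (rvar 4) (rvar 5)))
      (.flip (.div (rvar 5) (rvar 4)) storeChoice .skip))

/-- One step of reservoir sampling. -/
def offerOffset : Prog :=
  .seq (.ite freeTest offerFree .skip) nextOffset

/-- Random choice of the column of one row. -/
def sampleRow : Prog :=
  .seq (.setReal 4 (.const 0) (.ofNat (.const 0)))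
    (.seq (.setNat 6 (.const 0) (.const 0))
      (.seq (.setNat 7 (.const 0) (.const 1))
        (.seq (.setNat 8 (.const 0) nextBase)
          (.seq (.setNat 9 (.const 0) (.const 0)) (.while offsetsLeft offerOffset)))))

/-- Random choice of the column of one row, and passage to the next row. -/
def sampleAndStore : Prog :=
  .seq sampleRow (.seq (.setNat 10 rowExpr (nvar 9)) (.setNat 5 (.const 0) (nvar 8)))

/-- Random choice of the columns of all rows. -/
def sampleRows : Prog :=
  .seq (.setNat 5 (.const 0) (.sub (nvar 5) (nvar 4)))
    (.while (.natLe (nvar 4) (nvar 5)) sampleAndStore)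

/-- Composition of the sampled permutation with the central ranking. -/
def writeOutput : Prog :=
  .seq (.setNat 11 (.const 0) (.const 0))
    (.while (.natLe (.add (nvar 11) (.const 1)) (nvar 0))
      (.seq (.setNat 2 (nvar 11) (.load 10 (.load 1 (nvar 11))))
        (.setNat 11 (.const 0) (.add (nvar 11) (.const 1)))))

/-- The row is being scanned, with `ω` the current choice of the next mask and of the column, and
`g` the columns of the rows before it. -/
structure Offer (n k : ℕ) (α β : ℝ) (c : ℕ → ℕ) (B e mask d : ℕ) (acc : ℝ) (g : ℕ → ℕ)
    (ω : ℕ × ℕ) (s : State) : Prop where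
  scan : Scan n k α β c B e mask d acc s
  next : s.nat 8 0 = e * 2 ^ (2 * k + 1) + ω.1
  lt : ω.1 < 2 ^ (2 * k + 1)
  column : s.nat 9 0 = ω.2
  columns : s.nat 10 = g

/-- The first `j` rows are sampled, and `ω` consists of the current mask and of the columns. -/
structure Sampled (n k : ℕ) (α β : ℝ) (c : ℕ → ℕ) (j : ℕ) (ω : ℕ × (ℕ → ℕ)) (s : State) :
    Prop where
  ready : Ready n k α β c s
  pointer : s.nat 5 0 = (n - j) * 2 ^ (2 * k + 1) + ω.1
  lt : ω.1 < 2 ^ (2 * k + 1)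
  columns : s.nat 10 = ω.2
  table : TableBelow n k α β ((n + 1) * 2 ^ (2 * k + 1)) s

attribute [local simp] nvar rvar NExpr.eval RExpr.eval Test.holds State.setNat_nat_of_ne

variable {n k : ℕ} {α β : ℝ} {c g : ℕ → ℕ} {s : State} {B e mask d : ℕ} {acc : ℝ} {ω : ℕ × ℕ}

namespace Offer

theorem nextOffset (h : Offer n k α β c B e mask d acc g ω s) :
    Offer n k α β c B e mask (d + 1) acc g ω
      ((s.setNat 6 0 (d + 1)).setNat 7 0 (2 ^ (d + 1))) where
  scan := h.scan.nextOffset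
  next := by simp [h.next]
  lt := h.lt
  column := by simp [h.column]
  columns := by simp [h.columns]

theorem setSum (h : Offer n k α β c B e mask d acc g ω s) (u v : ℝ) :
    Offer n k α β c B e mask d v g ω ((s.setReal 5 0 u).setReal 4 0 v) where
  scan :=
    { ready := (h.scan.ready.setReal (by norm_num)).setReal (by norm_num)
      pointer := h.scan.pointer
      offset := h.scan.offset
      power := h.scan.power
      sum := by simp
      table := (h.scan.table.setReal (by norm_num)).setReal (by norm_num) }
  next := h.next
  lt := h.lt
  column := h.column
  columns := h.columns

theorem triple_storeChoice (hmask : mask < 2 ^ (2 * k + 1)) (hd : d < 2 * k + 1)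
    (h : Offer n k α β c B e mask d acc g ω s) :
    Triple [storeChoice] s 3 (PMF.pure ((mask + 2 ^ d) / 2, n - (e + 1) + d - k))
      (Offer n k α β c B e mask d acc g) := by
  have hnext := h.scan.setNat (a := 8) (i := 0) (v := e * 2 ^ (2 * k + 1) + (mask + 2 ^ d) / 2)
    (by norm_num)
  refine .setNat_seq (.setNat _ ?_)
  rw [h.scan.eval_nextExpr hmask]
  simp only [nvar, NExpr.eval, hnext.eval_rowExpr hmask, hnext.offset, hnext.ready.width]
  exact
    { scan := hnext.setNat (by norm_num)
      next := by simp
      lt := half_add_two_pow_lt hmask hd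
      column := by simp
      columns := by simp [h.columns] }

theorem triple_offerFree (hα : α ≠ 0) (hmask : mask < 2 ^ (2 * k + 1)) (hd : d < 2 * k + 1)
    (hB : (e + 1) * 2 ^ (2 * k + 1) ≤ B) (hfree : Free n k (n - (e + 1)) mask d)
    (h : Offer n k α β c B e mask d
      (∑ d' ∈ range d, rowTerm n k (offsetWeight α β k) e mask d') g ω s) :
    Triple [offerFree] s 8 (rowStep n k (offsetWeight α β k) e mask d ω)
      (Offer n k α β c B e mask d
        (∑ d' ∈ range (d + 1), rowTerm n k (offsetWeight α β k) e mask d') g) := by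
  set u := rowTerm n k (offsetWeight α β k) e mask d with hu
  set v := ∑ d' ∈ range (d + 1), rowTerm n k (offsetWeight α β k) e mask d' with hv
  have hsum : (RExpr.add (rvar 4) (rvar 5)).eval (s.setReal 5 0 u) = v := by
    simp [h.scan.sum, hv, sum_range_succ, hu]
  have hbias : u / v = (RExpr.div (rvar 5) (rvar 4)).eval ((s.setReal 5 0 u).setReal 4 0 v) := by
    simp
  refine .setReal_seq (.setReal_seq ?_)
  simp only [NExpr.eval, h.scan.eval_termExpr hα hmask hd hB hfree]
  rw [hsum, rowStep, reservoirStep, hbias]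
  exact .flip ((h.setSum u v).triple_storeChoice hmask hd)
    ((Triple.skip ω (h.setSum u v)).mono (by norm_num) fun _ _ => id)

theorem triple_offerOffset (hα : α ≠ 0) (hmask : mask < 2 ^ (2 * k + 1)) (hd : d < 2 * k + 1)
    (hB : (e + 1) * 2 ^ (2 * k + 1) ≤ B)
    (h : Offer n k α β c B e mask d
      (∑ d' ∈ range d, rowTerm n k (offsetWeight α β k) e mask d') g ω s) :
    Triple [offerOffset] s 13 (rowStep n k (offsetWeight α β k) e mask d ω)
      (Offer n k α β c B e mask (d + 1)
        (∑ d' ∈ range (d + 1), rowTerm n k (offsetWeight α β k) e mask d') g) := by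
  have hselect : Triple [.ite freeTest offerFree .skip] s 9
      (rowStep n k (offsetWeight α β k) e mask d ω) (Offer n k α β c B e mask d
        (∑ d' ∈ range (d + 1), rowTerm n k (offsetWeight α β k) e mask d') g) := by
    by_cases hfree : Free n k (n - (e + 1)) mask d
    · exact .ite_true ((h.scan.holds_freeTest_iff hmask).2 hfree)
        (h.triple_offerFree hα hmask hd hB hfree)
    · have hzero : rowTerm n k (offsetWeight α β k) e mask d = 0 := if_neg hfree
      rw [rowStep, reservoirStep_of_eq_zero hzero, sum_range_succ, hzero, add_zero]
      exact .mono (.ite_false (mt (h.scan.holds_freeTest_iff hmask).1 hfree) (.skip ω h))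
        (by norm_num) fun _ _ => id
  rw [← (rowStep n k (offsetWeight α β k) e mask d ω).bind_pure]
  exact hselect.seq fun ω s' h => h.scan.triple_nextOffset ω h.nextOffset

end Offer

theorem triple_sampleRow (hα : α ≠ 0) (hmask : mask < 2 ^ (2 * k + 1))
    (hB : (e + 1) * 2 ^ (2 * k + 1) ≤ B) (hr : Ready n k α β c s)
    (hpointer : s.nat 5 0 = (e + 1) * 2 ^ (2 * k + 1) + mask) (htable : TableBelow n k α β B s)
    (hcolumns : s.nat 10 = g) :
    Triple [sampleRow] s ((2 * k + 1) * 14 + 11)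
      (chain (rowStep n k (offsetWeight α β k) e mask) 0 (2 * k + 1) (0, 0))
      (Offer n k α β c B e mask (2 * k + 1)
        (∑ d ∈ range (2 * k + 1), rowTerm n k (offsetWeight α β k) e mask d) g) := by
  have hscan := scan_zero hr hpointer htable
  refine .setReal_seq (.setNat_seq (.setNat_seq (.setNat_seq (.setNat_seq (.while_loop (c := 13)
    (fun d => Offer n k α β c B e mask d
      (∑ d' ∈ range d, rowTerm n k (offsetWeight α β k) e mask d') g) _
    (fun d hd ω s' h => ⟨h.scan.holds_offsetsLeft_iff.2 hd, h.triple_offerOffset hα hmask hd hB⟩)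
    (fun ω s' h => mt h.scan.holds_offsetsLeft_iff.1 (lt_irrefl _)) ?_)))))
  simp only [NExpr.eval, RExpr.eval, Nat.cast_zero, range_zero, sum_empty,
    hscan.eval_nextBase hmask]
  exact
    { scan := (hscan.setNat (by norm_num)).setNat (by norm_num)
      next := by simp
      lt := by positivity
      column := by simp
      columns := by simp [hcolumns] }

theorem Sampled.triple_sampleAndStore (hα : α ≠ 0) {j : ℕ} (hj : j < n) {ω : ℕ × (ℕ → ℕ)}
    (h : Sampled n k α β c j ω s) :
    Triple [sampleAndStore] s ((2 * k + 1) * 14 + 15) (sampleStep n k (offsetWeight α β k) j ω)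
      (Sampled n k α β c (j + 1)) := by
  obtain ⟨e, rfl⟩ : ∃ e, n = e + 1 + j := ⟨n - (j + 1), by lia⟩
  have hpointer := h.pointer
  have he : e + 1 + j - (j + 1) = e := by lia
  rw [sampleStep, he]
  rw [Nat.add_sub_cancel] at hpointer
  refine .seq (t₂ := 3) (triple_sampleRow hα (B := (e + 1 + j + 1) * 2 ^ (2 * k + 1)) h.lt
    (Nat.mul_le_mul_right _ (by lia)) h.ready hpointer h.table h.columns) fun x s' h' =>
      .setNat_seq (.setNat _ ?_)
  rw [h'.scan.eval_rowExpr h.lt, Nat.add_sub_cancel_left]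
  exact
    { ready := (h'.scan.ready.setNat (by norm_num)).setNat (by norm_num)
      pointer := by simp [h'.next, he]
      lt := h'.lt
      columns := by
        funext i
        simp [h'.column, h'.columns, Function.update_apply]
      table := h'.scan.table }

theorem Filled.triple_sampleRows (hα : α ≠ 0) (h : Filled n k α β c s) :
    Triple [sampleRows] s (n * ((2 * k + 1) * 14 + 16) + 3)
      (chain (sampleStep n k (offsetWeight α β k)) 0 n (0, s.nat 10)) (Sampled n k α β c n) := by
  refine .setNat_seq (.while_loop (c := (2 * k + 1) * 14 + 15) (Sampled n k α β c) _
    (fun j hj ω s' h => ⟨?_, h.triple_sampleAndStore hα hj⟩) (fun ω s' h => ?_) ?_)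
  · simp only [Test.holds, nvar, NExpr.eval, h.ready.masks, h.pointer]
    exact (Nat.le_mul_of_pos_left _ (Nat.sub_pos_of_lt hj)).trans (Nat.le_add_right _ _)
  · simpa [h.ready.masks, h.pointer] using h.lt
  · exact
      { ready := h.ready.setNat (by norm_num)
        pointer := by simp [h.pointer, h.ready.masks, Nat.succ_mul]
        lt := by positivity
        columns := by simp
        table := h.table }

theorem Sampled.triple_writeOutput {ω : ℕ × (ℕ → ℕ)} (h : Sampled n k α β c n ω s) :
    Triple [writeOutput] s (n * 4 + 3) (PMF.pure ω)
      fun ω s' => ∀ i < n, s'.nat 2 i = ω.2 (c i) := by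
  rw [← chain_pure 0 n ω]
  refine .mono (.setNat_seq (.while_loop (c := 3) (fun j ω s' => s'.nat 0 0 = n ∧ s'.nat 1 = c ∧
    s'.nat 10 = ω.2 ∧ s'.nat 11 0 = j ∧ ∀ i < j, s'.nat 2 i = ω.2 (c i)) _ ?_ ?_ ?_)) le_rfl
    fun ω s' h => h.2.2.2.2
  · rintro j hj ω s' ⟨hsize, hcenter, hcolumns, hcounter, hout⟩
    refine ⟨by simpa [hsize, hcounter] using hj, .setNat_seq (.setNat ω ⟨by simp [hsize],
      by simp [hcenter], by simp [hcolumns], by simp [hcounter], fun i hi => ?_⟩)⟩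
    rcases Nat.lt_succ_iff_lt_or_eq.1 hi with hi | rfl
    · simp [hcounter, hi.ne, hout i hi]
    · simp [hcounter, hcenter, hcolumns]
  · rintro ω s' ⟨hsize, -, -, hcounter, -⟩
    simp [hsize, hcounter]
  · exact ⟨by simp [h.ready.size], by simp [h.ready.center], by simp [h.columns], by simp,
      fun i hi => absurd hi (Nat.not_lt_zero i)⟩

end Sampling

section Width

/-- The least exponent `t` with `x ≤ 2 ^ t`. -/
noncomputable def doublings (x : ℝ) : ℕ := Nat.clog 2 ⌈x⌉₊

/-- The band half-width that the programs use. -/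
noncomputable def halfWidth (K n : ℕ) (ε : ℝ) : ℕ := K * (doublings (1 + n / ε) + 1)

variable {x ε : ℝ}

theorem doublings_le_iff {t : ℕ} : doublings x ≤ t ↔ x ≤ 2 ^ t := by
  rw [doublings, Nat.clog_le_iff_le_pow one_lt_two, Nat.ceil_le, Nat.cast_pow, Nat.cast_two]

theorem two_pow_doublings_le (hx : 1 ≤ x) : 2 ^ doublings x ≤ 2 * x := by
  rcases h : doublings x with _ | t
  · rw [pow_zero]
    linarith
  · rw [pow_succ']
    have : 2 ^ t < x := not_le.1 (mt doublings_le_iff.2 (by lia))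
    linarith

theorem doublings_le_log (hx : 1 ≤ x) : doublings x ≤ 2 * Real.log x + 1 := by
  have hlog2 : 1 / 2 ≤ Real.log 2 := by linarith [Real.log_two_gt_d9]
  have hlog := Real.log_le_log (by positivity) (two_pow_doublings_le hx)
  rw [Real.log_pow, Real.log_mul two_ne_zero (by positivity)] at hlog
  nlinarith [Real.log_nonneg hx]

theorem one_le_one_add_div (n : ℕ) (hε : 0 < ε) : 1 ≤ 1 + n / ε :=
  le_add_of_nonneg_right (by positivity)

theorem halfWidth_le (K n : ℕ) (hε : 0 < ε) :
    halfWidth K n ε ≤ 2 * K * (1 + Real.log (1 + n / ε)) := by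
  have := doublings_le_log (one_le_one_add_div n hε)
  calc (halfWidth K n ε : ℝ) = K * (doublings (1 + n / ε) + 1) := by
        rw [halfWidth, Nat.cast_mul, Nat.cast_succ]
    _ ≤ K * (2 * (1 + Real.log (1 + n / ε))) := by
        gcongr
        linarith
    _ = 2 * K * (1 + Real.log (1 + n / ε)) := by ring

theorem two_mul_mul_half_pow_le (n : ℕ) (hε : 0 < ε) :
    2 * n * (1 / 2) ^ (doublings (1 + n / ε) + 1) ≤ ε := by
  have h : (n : ℝ) / ε ≤ 2 ^ doublings (1 + n / ε) :=
    (le_add_of_nonneg_left zero_le_one).trans (doublings_le_iff.1 le_rfl)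
  rw [div_le_iff₀' hε] at h
  calc 2 * (n : ℝ) * (1 / 2) ^ (doublings (1 + n / ε) + 1)
      = (n : ℝ) / 2 ^ doublings (1 + n / ε) := by
        rw [one_div, inv_pow, pow_succ]
        field_simp
    _ ≤ ε := div_le_of_le_mul₀ (by positivity) hε.le h

end Width

section Programs

/-- The number `1 + n / ε`. -/
def ratioExpr : RExpr :=
  .add (.ofNat (.const 1)) (.div (.ofNat (nvar 0)) (.load 0 (.const 2)))

/-- Computation of the half-width. -/
def findWidth (K : ℕ) : Prog :=
  .seq (.setReal 2 (.const 0) (.ofNat (.const 1)))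
    (.seq (.setNat 3 (.const 0) (.const K))
      (.while (.not (.realLe ratioExpr (rvar 2)))
        (.seq (.setReal 2 (.const 0) (.add (rvar 2) (rvar 2)))
          (.setNat 3 (.const 0) (.add (nvar 3) (.const K))))))

/-- Computation of the number of masks. -/
def countMasks : Prog :=
  .seq (.setNat 4 (.const 0) (.const 1))
    (.seq (.setNat 5 (.const 0) (.const 0))
      (.while (.natLe (.add (nvar 5) (.const 1)) (.add (.add (nvar 3) (nvar 3)) (.const 1)))
        (.seq (.setNat 4 (.const 0) (.add (nvar 4) (nvar 4)))
          (.setNat 5 (.const 0) (.add (nvar 5) (.const 1))))))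

/-- The common part of the two programs. -/
def prepare (K : ℕ) : Prog := .seq (findWidth K) (.seq countMasks fillTable)

/-- The program that returns the permanent of the band matrix. -/
def estimatorProg (K : ℕ) : Prog :=
  .seq (prepare K) (.setReal 1 (.const 0) (.load 3 (.sub (nvar 5) (nvar 4))))

/-- The program that samples from the truncated Mallows distribution. -/
def samplerProg (K : ℕ) : Prog := .seq (prepare K) (.seq sampleRows writeOutput)

theorem estimatorProg_deterministic (K : ℕ) : (estimatorProg K).Deterministic := by
  simp [estimatorProg, prepare, findWidth, countMasks, fillTable, computeCell, expandRow, addTerm,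
    nextOffset, Prog.Deterministic]

/-- The memory holds the input. -/
structure Start (n : ℕ) (α β ε : ℝ) (c : ℕ → ℕ) (s : State) : Prop where
  size : s.nat 0 0 = n
  exponent : s.real 0 0 = α
  dispersion : s.real 0 1 = β
  accuracy : s.real 0 2 = ε
  center : s.nat 1 = c

attribute [local simp] nvar rvar NExpr.eval RExpr.eval Test.holds

variable {n k : ℕ} {α β ε : ℝ} {c : ℕ → ℕ} {s : State}

theorem start_input (n : ℕ) (α β ε : ℝ) : Start n α β ε (fun _ => 0) (input n α β ε) := by
  constructor <;> simp [input]

theorem start_inputWithCenter (α β ε : ℝ) (σ : Equiv.Perm (Fin n)) :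
    Start n α β ε (fun i => if h : i < n then (σ ⟨i, h⟩ : ℕ) else 0)
      (inputWithCenter α β ε σ) := by
  constructor <;> simp [inputWithCenter, input]

theorem Start.setNat (h : Start n α β ε c s) {a i v : ℕ} (ha : 1 < a) :
    Start n α β ε c (s.setNat a i v) where
  size := by rw [s.setNat_nat_of_ne i v (by lia), h.size]
  exponent := h.exponent
  dispersion := h.dispersion
  accuracy := h.accuracy
  center := by rw [s.setNat_nat_of_ne i v (by lia), h.center]

theorem Start.setReal (h : Start n α β ε c s) {a i : ℕ} {v : ℝ} (ha : 0 < a) :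
    Start n α β ε c (s.setReal a i v) where
  size := h.size
  exponent := by rw [s.setReal_real_apply, if_neg fun h => ha.ne h.1, h.exponent]
  dispersion := by rw [s.setReal_real_apply, if_neg fun h => ha.ne h.1, h.dispersion]
  accuracy := by rw [s.setReal_real_apply, if_neg fun h => ha.ne h.1, h.accuracy]
  center := h.center

theorem Start.triple_findWidth (K : ℕ) (h : Start n α β ε c s) :
    Triple [findWidth K] s (doublings (1 + n / ε) * 4 + 5) (PMF.pure ()) fun _ s' =>
      Start n α β ε c s' ∧ s'.nat 3 0 = halfWidth K n ε := by
  have htest : ∀ j s', Start n α β ε c s' → s'.real 2 0 = 2 ^ j →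
      ((Test.not (.realLe ratioExpr (rvar 2))).holds s' ↔ j < doublings (1 + n / ε)) := by
    intro j s' h' hpower
    rw [← not_le, doublings_le_iff]
    simp [ratioExpr, h'.size, h'.accuracy, hpower]
  refine .mono (.setReal_seq (.setNat_seq (.while_pure (m := doublings (1 + n / ε)) (c := 3)
    (fun j s' => Start n α β ε c s' ∧ s'.real 2 0 = 2 ^ j ∧ s'.nat 3 0 = K * (j + 1))
    ?_ ?_ ?_))) le_rfl fun _ s' h => ⟨h.1, h.2.2⟩
  · rintro j hj s' ⟨h, hpower, hwidth⟩
    refine ⟨(htest j s' h hpower).2 hj, .setReal_seq (.setNat ()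
      ⟨(h.setReal (by norm_num)).setNat (by norm_num), ?_, ?_⟩)⟩
    · simp [hpower, pow_succ, mul_two]
    · simp [hwidth, mul_add_one]
  · exact fun s' h => mt (htest _ s' h.1 h.2.1).1 (lt_irrefl _)
  · exact ⟨(h.setReal (by norm_num)).setNat (by norm_num), by simp, by simp⟩

theorem Start.triple_countMasks (h : Start n α β ε c s) (hk : s.nat 3 0 = k) :
    Triple [countMasks] s ((2 * k + 1) * 4 + 5) (PMF.pure ()) fun _ => Ready n k α β c := by
  refine .mono (.setNat_seq (.setNat_seq (.while_pure (m := 2 * k + 1) (c := 3)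
    (fun j s' => Start n α β ε c s' ∧ s'.nat 3 0 = k ∧ s'.nat 4 0 = 2 ^ j ∧ s'.nat 5 0 = j)
    ?_ ?_ ?_))) le_rfl
      fun _ s' h => ⟨h.1.size, h.2.1, h.2.2.1, h.1.exponent, h.1.dispersion, h.1.center⟩
  · rintro j hj s' ⟨h, hwidth, hpower, hcounter⟩
    refine ⟨?_, .setNat_seq (.setNat ()
      ⟨(h.setNat (by norm_num)).setNat (by norm_num), ?_, ?_, ?_⟩)⟩
    · simp only [Test.holds, nvar, NExpr.eval, hwidth, hcounter]
      lia
    · simp [hwidth]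
    · simp [hpower, pow_succ, mul_two]
    · simp [hcounter]
  · rintro s' ⟨-, hwidth, -, hcounter⟩
    simp only [Test.holds, nvar, NExpr.eval, hwidth, hcounter]
    lia
  · exact ⟨(h.setNat (by norm_num)).setNat (by norm_num), by simp [hk], by simp, by simp⟩

/-- A bound for the running times of both programs, with `t` doublings and half-width `k`. -/
def runningTime (n k t : ℕ) : ℕ :=
  (t * 4 + 5) + ((2 * k + 1) * 4 + 5) + ((n + 1) * 2 ^ (2 * k + 1) * ((2 * k + 1) * 7 + 13) + 3) +
    (n * ((2 * k + 1) * 14 + 16) + 3) + (n * 4 + 3) + 4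

theorem Start.triple_prepare (K : ℕ) (hα : α ≠ 0) (h : Start n α β ε c s)
    (hk : halfWidth K n ε = k) :
    Triple [prepare K] s ((doublings (1 + n / ε) * 4 + 5) + ((2 * k + 1) * 4 + 5) +
        ((n + 1) * 2 ^ (2 * k + 1) * ((2 * k + 1) * 7 + 13) + 3) + 2) (PMF.pure ())
      fun _ => Filled n k α β c :=
  (Triple.seq_pure (h.triple_findWidth K) fun _ h₁ =>
    .seq_pure (h₁.1.triple_countMasks (h₁.2.trans hk)) fun _ h₂ => triple_fillTable hα h₂).mono
      (by lia) fun _ _ => id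

theorem Filled.real_table_first (h : Filled n k α β c s) :
    s.real 3 (n * 2 ^ (2 * k + 1)) = (bandMatrix n α β k).permanent := by
  have hcell := h.table.read (e := n) (mask := 0) (by positivity) le_rfl
  rwa [add_zero, bandPermanent_eq_permanent, ← bandMatrix_eq_toeplitzBand] at hcell

theorem Start.triple_estimatorProg (K : ℕ) (hα : α ≠ 0) (h : Start n α β ε c s)
    (hk : halfWidth K n ε = k) :
    Triple [estimatorProg K] s (runningTime n k (doublings (1 + n / ε))) (PMF.pure ()) fun _ s' =>
      s'.realOutput = (bandMatrix n α β k).permanent := by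
  refine (Triple.seq_pure (h.triple_prepare K hα hk) fun s' h' => .setReal () ?_).mono
    (by unfold runningTime; lia) fun _ _ => id
  have hfirst : (n + 1) * 2 ^ (2 * k + 1) - 2 ^ (2 * k + 1) = n * 2 ^ (2 * k + 1) := by
    rw [Nat.succ_mul, Nat.add_sub_cancel]
  simp [State.realOutput, h'.pointer, h'.ready.masks, hfirst, h'.real_table_first]

theorem Start.triple_samplerProg (K : ℕ) (hα : α ≠ 0) (σ : Equiv.Perm (Fin n))
    (h : Start n α β ε c s) (hc : ∀ i : Fin n, c i = σ i) (hk : halfWidth K n ε = k) :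
    Triple [samplerProg K] s (runningTime n k (doublings (1 + n / ε)))
      ((truncatedMallows α β k σ).map values) fun v s' => s'.listOutput n = v := by
  refine (Triple.seq_pure (h.triple_prepare K hα hk) fun s' h' => ?_).mono
    (t := _ + (n * ((2 * k + 1) * 14 + 16) + 3 + (n * 4 + 3) + 1) + 1)
    (by unfold runningTime; lia) fun _ _ => id
  have hsample := (h'.triple_sampleRows hα).seq (κ := PMF.pure) fun ω s'' h'' =>
    h''.triple_writeOutput
  rw [PMF.bind_pure] at hsample
  rw [← chain_sampleStep_map α β k σ (s'.nat 10)]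
  refine hsample.map _ fun ω s'' h'' => funext fun i => ?_
  rw [State.listOutput, h'' i i.2, hc]

end Programs

section RunningTime

variable {ε : ℝ}

theorem runningTime_le (n k t : ℕ) :
    runningTime n k t ≤ 100 * ((n + 1) * 2 ^ (2 * k + 1) * 2 ^ (2 * k + 1)) + 4 * 2 ^ t := by
  have ht : t < 2 ^ t := Nat.lt_two_pow_self
  have hw : 2 * k + 1 < 2 ^ (2 * k + 1) := Nat.lt_two_pow_self
  have hP : 1 ≤ 2 ^ (2 * k + 1) := Nat.one_le_two_pow
  unfold runningTime
  set w := 2 * k + 1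
  set P := 2 ^ w
  nlinarith [Nat.mul_le_mul_left ((n + 1) * P) hw.le, Nat.mul_le_mul_left n hw.le,
    Nat.mul_le_mul_left ((n + 1) * P) hP, Nat.mul_le_mul_left n hP]

theorem one_add_div_le_sq (n : ℕ) (hε : 0 < ε) : 1 + n / ε ≤ (n + 1 / ε + 1) ^ 2 := by
  have : (0 : ℝ) ≤ n := Nat.cast_nonneg n
  have hi : 0 < 1 / ε := by positivity
  rw [div_eq_mul_one_div]
  nlinarith

theorem two_pow_doublings_le_sq (n : ℕ) (hε : 0 < ε) :
    (2 : ℝ) ^ doublings (1 + n / ε) ≤ 2 * (n + 1 / ε + 1) ^ 2 :=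
  (two_pow_doublings_le (one_le_one_add_div n hε)).trans
    (mul_le_mul_of_nonneg_left (one_add_div_le_sq n hε) zero_le_two)

theorem two_pow_halfWidth_le (K n : ℕ) (hε : 0 < ε) :
    (2 : ℝ) ^ (2 * halfWidth K n ε + 1) ≤ 2 * 16 ^ K * (n + 1 / ε + 1) ^ (4 * K) := by
  calc (2 : ℝ) ^ (2 * halfWidth K n ε + 1)
      = 2 * 4 ^ K * (2 ^ doublings (1 + n / ε)) ^ (2 * K) := by
        rw [halfWidth, show (4 : ℝ) = 2 ^ 2 by norm_num, ← pow_mul, ← pow_mul, mul_assoc, ← pow_add,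
          ← pow_succ']
        congr 1
        ring
    _ ≤ 2 * 4 ^ K * (2 * (n + 1 / ε + 1) ^ 2) ^ (2 * K) := by
        gcongr
        exact two_pow_doublings_le_sq n hε
    _ = 2 * 16 ^ K * (n + 1 / ε + 1) ^ (4 * K) := by
        rw [mul_pow, ← pow_mul, pow_mul 2 2 K, show (16 : ℝ) = 4 * 2 ^ 2 by norm_num, mul_pow 4]
        ring_nf

theorem runningTime_halfWidth_le (K n : ℕ) (hε : 0 < ε) :
    (runningTime n (halfWidth K n ε) (doublings (1 + n / ε)) : ℝ) ≤
      (400 * 256 ^ K + 8 : ℕ) * (n + 1 / ε + 1) ^ (8 * K + 2) := by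
  have hle : (runningTime n (halfWidth K n ε) (doublings (1 + n / ε)) : ℝ) ≤
      100 * ((n + 1) * 2 ^ (2 * halfWidth K n ε + 1) * 2 ^ (2 * halfWidth K n ε + 1)) +
        4 * 2 ^ doublings (1 + n / ε) := by
    exact_mod_cast runningTime_le n (halfWidth K n ε) (doublings (1 + n / ε))
  have hwidth := two_pow_halfWidth_le K n hε
  have hdoublings := two_pow_doublings_le_sq n hε
  have hi : 0 < 1 / ε := by positivity
  set Y : ℝ := n + 1 / ε + 1
  have hY : 1 ≤ Y := le_add_of_nonneg_left (by positivity)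
  calc _ ≤ _ := hle
    _ ≤ 100 * (Y * (2 * 16 ^ K * Y ^ (4 * K)) * (2 * 16 ^ K * Y ^ (4 * K))) + 4 * (2 * Y ^ 2) := by
        gcongr
        linarith
    _ = 400 * 256 ^ K * Y ^ (8 * K + 1) + 8 * Y ^ 2 := by
        rw [show (256 : ℝ) = 16 * 16 by norm_num, mul_pow]
        ring
    _ ≤ 400 * 256 ^ K * Y ^ (8 * K + 2) + 8 * Y ^ (8 * K + 2) := by
        gcongr <;> first | exact hY | lia
    _ = _ := by
        push_cast
        ring

end RunningTime

end RealRAM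

theorem theorem2 (α β : ℝ) (hα : 1 ≤ α) (hβ : 0 < β) :
    ∃ (estimator sampler : RealRAM.Prog) (C D : ℕ) (K : ℝ) (k : ℕ → ℝ → ℕ),
      estimator.Deterministic ∧
      ∀ (n : ℕ) (ε : ℝ), 0 < ε →
        ∃ T : ℕ, (T : ℝ) ≤ C * (n + 1 / ε + 1) ^ D ∧
          -- the half-width of the band
          (k n ε : ℝ) ≤ K * (1 + Real.log (1 + n / ε)) ∧
          -- (i) estimation of the partition function
          (estimator.HaltsWithin (RealRAM.input n α β ε) T ∧
            ∃ Zhat : ℝ,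
              (estimator.memoryAfter (RealRAM.input n α β ε) T).map RealRAM.State.realOutput = PMF.pure Zhat ∧
              Zhat = (Mallows.bandMatrix n α β (k n ε)).permanent ∧
              ∀ σ : Equiv.Perm (Fin n),
                (1 - ε) * Mallows.partitionFunction α β σ ≤ Zhat ∧ Zhat ≤ Mallows.partitionFunction α β σ) ∧
          -- (ii) sampling
          ∀ σ : Equiv.Perm (Fin n),
            sampler.HaltsWithin (RealRAM.inputWithCenter α β ε σ) T ∧
            ∃ ν : PMF (Equiv.Perm (Fin n)),
              (sampler.memoryAfter (RealRAM.inputWithCenter α β ε σ) T).map (RealRAM.State.listOutput n) =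
                ν.map Mallows.values ∧
              ν = Mallows.truncatedMallows α β (k n ε) σ ∧
              Mallows.tvDist ν (Mallows.mallows α β σ) ≤ ε := by
  obtain ⟨K, hK⟩ := Mallows.exists_sum_weight_not_inBand_le hβ
  have hα₀ : α ≠ 0 := by positivity
  refine ⟨RealRAM.estimatorProg K, RealRAM.samplerProg K, 400 * 256 ^ K + 8, 8 * K + 2, 2 * K,
    RealRAM.halfWidth K, RealRAM.estimatorProg_deterministic K, fun n ε hε => ?_⟩
  have htail : ∑ π : Equiv.Perm (Fin n) with ¬ Mallows.InBand (RealRAM.halfWidth K n ε) π,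
      Mallows.weight (Mallows.powerCost α) β π ≤
        ε * ∑ π : Equiv.Perm (Fin n), Mallows.weight (Mallows.powerCost α) β π :=
    (hK _ (Mallows.isStronglyMonge_powerCost hα) n _).trans (mul_le_mul_of_nonneg_right
      (RealRAM.two_mul_mul_half_pow_le n hε)
      (Finset.sum_nonneg fun π _ => (Mallows.weight_pos _ β π).le))
  refine ⟨_, RealRAM.runningTime_halfWidth_le K n hε, RealRAM.halfWidth_le K n hε, ?_,
    fun σ => ?_⟩
  · have h := (RealRAM.start_input n α β ε).triple_estimatorProg K hα₀ rfl
    refine ⟨h.haltsWithin, _, ?_, rfl, fun σ =>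
      ⟨Mallows.le_permanent_bandMatrix σ htail, Mallows.permanent_bandMatrix_le α β _ σ⟩⟩
    rw [h.map_memoryAfter (g := fun _ => _) fun _ _ h => h, PMF.pure_map]
  · have h := (RealRAM.start_inputWithCenter α β ε σ).triple_samplerProg K hα₀ σ
      (fun i => by simp) rfl
    refine ⟨h.haltsWithin, _, ?_, rfl,
      Mallows.tvDist_truncatedMallows_le σ (Mallows.le_permanent_bandMatrix σ htail)⟩
    rw [h.map_memoryAfter (g := id) fun _ _ h => h, PMF.map_id]
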